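/- Let $S\subset\mathbb{R}^2$ be a finite non-empty set of points in general position, meaning that no four points of $S$ lie on a common circle. For $p\in S$ let $\mathrm{cell}(p)$ be the set of points $q$ of the plane such that $d(q,p)=\max_{p'\in S}d(q,p')$. A vertex of the farthest-point Voronoi diagram of $S$ is a point $v$ for which there are three distinct points $p_1,p_2,p_3\in S$ (its defining points) with $\mathrm{cell}(p_1)\cap\mathrm{cell}(p_2)\cap\mathrm{cell}(p_3)=\{v\}$; an edge is a set $\mathrm{cell}(p_1)\cap\mathrm{cell}(p_2)$ with more than one point, where $p_1\ne p_2$ are points of $S$ (its defining points). The vertices and the bounded edges form a tree $T$ (which is empty if the diagram has no vertices). A centroid of a tree with $k$ vertices is a vertex whose removal leaves subtrees with at most $k/2$ vertices each. A centroid decomposition of a non-empty tree is the rooted tree obtained by choosing a centroid as the root and making the roots of centroid decompositions, formed recursively, of the remaining subtrees its children; that of the empty tree is empty. There are a fixed program for the real RAM (unit cost; operations $+,-,\times,/$ and comparisons on real registers; addition, subtraction and comparisons on index registers; random access to arrays; no square roots and no rounding) and a constant $K$ such that the following holds for every such $S$. Suppose that the memory contains the coordinates of the points of $S$; the farthest-point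 Voronoi diagram of $S$, that is, its vertices with their coordinates, three defining points and three incident edges each, and its edges with their defining points and their end vertices; and a centroid decomposition of $T$, that is, its root and, for each vertex, pointers to its at most three children; all listed in arbitrary order. Then the program halts after at most $K(1+\log|S|)$ steps and returns the coordinates of the centre and the square of the radius of the smallest enclosing disk of $S$. In particular, given $S$, its farthest-point Voronoi diagram and a centroid decomposition of the diagram, the smallest enclosing disk of $S$ can be found in time $O(\log|S|)$. -/

import Mathlib

noncomputable section

/-- The Euclidean plane. -/
abbrev Plane : Type := EuclideanSpace ℝ (Fin 2)

/-! ### Smallest enclosing disks and farthest-point Voronoi diagrams -/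

/-- The closed disk with centre `c` and radius `r` encloses `S` and no disk enclosing `S`
has a smaller radius. -/
def IsSmallestEnclosingDisk (S : Finset Plane) (c : Plane) (r : ℝ) : Prop :=
  0 ≤ r ∧ (S : Set Plane) ⊆ Metric.closedBall c r ∧
    ∀ (c' : Plane) (r' : ℝ), (S : Set Plane) ⊆ Metric.closedBall c' r' → r ≤ r'

/-- General position: no four points of `S` lie on a common circle. -/
def InGeneralPosition (S : Finset Plane) : Prop :=
  ∀ T : Finset Plane, T ⊆ S → T.card = 4 → ¬ EuclideanGeometry.Cospherical (T : Set Plane)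

/-- The cell of `p`: the points of the plane from which `p` is a farthest point of `S`. -/
def fpvdCell (S : Finset Plane) (p : Plane) : Set Plane :=
  {q | ∀ p' ∈ S, dist q p' ≤ dist q p}

/-- `p₁, p₂, p₃` are three defining points of the vertex `v`. -/
def DefinesVertex (S : Finset Plane) (p₁ p₂ p₃ v : Plane) : Prop :=
  p₁ ∈ S ∧ p₂ ∈ S ∧ p₃ ∈ S ∧ p₁ ≠ p₂ ∧ p₁ ≠ p₃ ∧ p₂ ≠ p₃ ∧
    fpvdCell S p₁ ∩ fpvdCell S p₂ ∩ fpvdCell S p₃ = {v}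

/-- `p₁, p₂` are the defining points of an edge, which is then the set
`fpvdCell S p₁ ∩ fpvdCell S p₂` (a segment, a half-line or a line). -/
def DefinesEdge (S : Finset Plane) (p₁ p₂ : Plane) : Prop :=
  p₁ ∈ S ∧ p₂ ∈ S ∧ p₁ ≠ p₂ ∧ (fpvdCell S p₁ ∩ fpvdCell S p₂).Nontrivial

/-- Tables describing a subdivision of the plane: sites, vertices with three defining sites and
three incident edges each, and edges with two defining sites and at most two end vertices each
(a missing end vertex means that the edge is unbounded on that side). -/
structure DiagramTables where
  numSites : ℕ
  numVertices : ℕ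
  numEdges : ℕ
  site : Fin numSites → Plane
  vertex : Fin numVertices → Plane
  vertexSite : Fin numVertices → Fin 3 → Fin numSites
  vertexEdge : Fin numVertices → Fin 3 → Fin numEdges
  edgeSite : Fin numEdges → Fin 2 → Fin numSites
  edgeEnd : Fin numEdges → Fin 2 → Option (Fin numVertices)

namespace DiagramTables

/-- The set of points on edge number `e`. -/
def edgeSet (D : DiagramTables) (S : Finset Plane) (e : Fin D.numEdges) : Set Plane :=
  fpvdCell S (D.site (D.edgeSite e 0)) ∩ fpvdCell S (D.site (D.edgeSite e 1))

/-- The tables `D` list the points of `S` and describe the farthest-point Voronoi diagram of `S`.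
The numbering of sites, vertices and edges, and the order in which the defining sites, incident
edges and end vertices are listed, are arbitrary. -/
structure IsFPVD (D : DiagramTables) (S : Finset Plane) : Prop where
  site_injective : Function.Injective D.site
  site_range : Set.range D.site = (S : Set Plane)
  vertex_injective : Function.Injective D.vertex
  vertex_range : Set.range D.vertex = {v | ∃ p₁ p₂ p₃, DefinesVertex S p₁ p₂ p₃ v}
  vertexSite_spec : ∀ j, DefinesVertex S (D.site (D.vertexSite j 0)) (D.site (D.vertexSite j 1))
    (D.site (D.vertexSite j 2)) (D.vertex j)
  edgeSite_spec : ∀ e, DefinesEdge S (D.site (D.edgeSite e 0)) (D.site (D.edgeSite e 1))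
  edge_complete : ∀ p q, DefinesEdge S p q →
    ∃! e, s(D.site (D.edgeSite e 0), D.site (D.edgeSite e 1)) = s(p, q)
  vertexEdge_spec : ∀ j e, (∃ k, D.vertexEdge j k = e) ↔ D.vertex j ∈ D.edgeSet S e
  edgeEnd_spec : ∀ e j, (∃ k, D.edgeEnd e k = some j) ↔ D.vertex j ∈ D.edgeSet S e
  edgeEnd_ne : ∀ e j, D.edgeEnd e 0 = some j → D.edgeEnd e 1 ≠ some j

/-- The tree formed by the vertices and the bounded edges of the diagram. -/
def graph (D : DiagramTables) : SimpleGraph (Fin D.numVertices) where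
  Adj i j := i ≠ j ∧ ∃ e, (∃ k, D.edgeEnd e k = some i) ∧ (∃ k, D.edgeEnd e k = some j)
  symm := ⟨fun _ _ h => ⟨h.1.symm, h.2.imp fun _ he => he.symm⟩⟩
  loopless := ⟨fun _ h => h.1 rfl⟩

end DiagramTables

/-! ### Centroid decompositions -/

/-- The vertex sets of the connected components that remain when `v` is removed from the subgraph
of `G` induced by `A`. -/
def piecesAfterRemoval {V : Type*} (G : SimpleGraph V) (A : Set V) (v : V) : Set (Set V) :=
  Set.range fun c : (G.induce (A \ {v})).ConnectedComponent => Subtype.val '' c.supp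

/-- `IsCentroidTree G child A v`: the rooted tree with root `v` described by the child pointers
`child` is a centroid decomposition of the subgraph of `G` induced by `A`. That is, `v` is a
centroid of it, and the children of `v` are the roots of centroid decompositions of the pieces
that remain when `v` is removed, one child for each piece. -/
inductive IsCentroidTree {V : Type*} (G : SimpleGraph V) (child : V → Fin 3 → Option V) :
    Set V → V → Prop
  | node (A : Set V) (v : V) (mem : v ∈ A)
      (half : ∀ C ∈ piecesAfterRemoval G A v, 2 * C.ncard ≤ A.ncard)
      (child_mem : ∀ i w, child v i = some w → w ∈ A \ {v})
      (one_child : ∀ C ∈ piecesAfterRemoval G A v, ∃! i, ∃ w ∈ C, child v i = some w)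
      (sub : ∀ C ∈ piecesAfterRemoval G A v, ∀ i, ∀ w ∈ C, child v i = some w →
        IsCentroidTree G child C w) :
      IsCentroidTree G child A v

/-- Centroid decomposition of `G`, given by its root and the child pointers; there is no root if
`G` has no vertices. -/
def IsCentroidDecomposition {V : Type*} (G : SimpleGraph V) (root : Option V)
    (child : V → Fin 3 → Option V) : Prop :=
  (root = none → IsEmpty V) ∧ ∀ r, root = some r → IsCentroidTree G child Set.univ r

/-! ### Real RAM programs with unit cost -/

namespace RealRAM

/-- A state: registers and random access arrays for natural numbers (indices, pointers) and for
real numbers. -/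
structure State where
  nat : ℕ → ℕ
  real : ℕ → ℝ
  natArr : ℕ → ℕ → ℕ
  realArr : ℕ → ℕ → ℝ

/-- Elementary operations. The first argument of all but the two store operations is the target
register; array names are fixed in the program, indices are read from a register. -/
inductive Op
  | nconst (r c : ℕ)
  | ncopy (r s : ℕ)
  | nadd (r s t : ℕ)
  | nsub (r s t : ℕ)
  | nload (r arr i : ℕ)
  | nstore (arr i s : ℕ)
  | rconst (r : ℕ) (c : ℤ)
  | rcopy (r s : ℕ)
  | radd (r s t : ℕ)
  | rsub (r s t : ℕ)
  | rmul (r s t : ℕ)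
  | rdiv (r s t : ℕ)
  | rload (r arr i : ℕ)
  | rstore (arr i s : ℕ)

open Function in
/-- The effect of an elementary operation. -/
def Op.apply : Op → State → State
  | nconst r c, σ => { σ with nat := update σ.nat r c }
  | ncopy r s, σ => { σ with nat := update σ.nat r (σ.nat s) }
  | nadd r s t, σ => { σ with nat := update σ.nat r (σ.nat s + σ.nat t) }
  | nsub r s t, σ => { σ with nat := update σ.nat r (σ.nat s - σ.nat t) }
  | nload r a i, σ => { σ with nat := update σ.nat r (σ.natArr a (σ.nat i)) }
  | nstore a i s, σ =>
    { σ with natArr := update σ.natArr a (update (σ.natArr a) (σ.nat i) (σ.nat s)) }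
  | rconst r c, σ => { σ with real := update σ.real r (c : ℝ) }
  | rcopy r s, σ => { σ with real := update σ.real r (σ.real s) }
  | radd r s t, σ => { σ with real := update σ.real r (σ.real s + σ.real t) }
  | rsub r s t, σ => { σ with real := update σ.real r (σ.real s - σ.real t) }
  | rmul r s t, σ => { σ with real := update σ.real r (σ.real s * σ.real t) }
  | rdiv r s t, σ => { σ with real := update σ.real r (σ.real s / σ.real t) }
  | rload r a i, σ => { σ with real := update σ.real r (σ.realArr a (σ.nat i)) }
  | rstore a i s, σ =>
    { σ with realArr := update σ.realArr a (update (σ.realArr a) (σ.nat i) (σ.real s)) }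

/-- Elementary tests: comparisons of two registers. -/
inductive Test
  | natEq (r s : ℕ)
  | natLt (r s : ℕ)
  | realEq (r s : ℕ)
  | realLt (r s : ℕ)

/-- The meaning of the tests. -/
def Test.Holds : Test → State → Prop
  | natEq r s, σ => σ.nat r = σ.nat s
  | natLt r s, σ => σ.nat r < σ.nat s
  | realEq r s, σ => σ.real r = σ.real s
  | realLt r s, σ => σ.real r < σ.real s

/-- Structured programs. -/
inductive Program
  | skip
  | op (o : Op)
  | seq (P Q : Program)
  | ite (b : Test) (P Q : Program)
  | loop (b : Test) (P : Program)

/-- `Exec P σ τ t`: started in state `σ`, the program `P` halts in state `τ` after `t` steps,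
where every elementary operation and every elementary test counts as one step. The program
`loop b P` repeats `P` as long as `b` holds. -/
inductive Exec : Program → State → State → ℕ → Prop
  | skip (σ : State) : Exec .skip σ σ 0
  | op (o : Op) (σ : State) : Exec (.op o) σ (o.apply σ) 1
  | seq {P Q : Program} {σ τ ρ : State} {s t : ℕ} :
      Exec P σ τ s → Exec Q τ ρ t → Exec (.seq P Q) σ ρ (s + t)
  | ite_true {b : Test} {P Q : Program} {σ τ : State} {t : ℕ} :
      b.Holds σ → Exec P σ τ t → Exec (.ite b P Q) σ τ (t + 1)
  | ite_false {b : Test} {P Q : Program} {σ τ : State} {t : ℕ} :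
      ¬ b.Holds σ → Exec Q σ τ t → Exec (.ite b P Q) σ τ (t + 1)
  | loop_true {b : Test} {P : Program} {σ τ ρ : State} {s t : ℕ} :
      b.Holds σ → Exec P σ τ s → Exec (.loop b P) τ ρ t → Exec (.loop b P) σ ρ (s + t + 1)
  | loop_false {b : Test} {P : Program} {σ : State} :
      ¬ b.Holds σ → Exec (.loop b P) σ σ 1

/-- Optional pointers in memory: `0` is the null pointer, `j + 1` points to record `j`. -/
def encodePointer {m : ℕ} : Option (Fin m) → ℕ
  | none => 0
  | some j => j + 1

/-- The memory contains the tables `D`, the root pointer and the child pointers. All registers and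
array entries that are not mentioned have arbitrary contents. -/
structure HoldsInput (σ : State) (D : DiagramTables) (root : Option (Fin D.numVertices))
    (child : Fin D.numVertices → Fin 3 → Option (Fin D.numVertices)) : Prop where
  numSites : σ.nat 0 = D.numSites
  numVertices : σ.nat 1 = D.numVertices
  numEdges : σ.nat 2 = D.numEdges
  root : σ.nat 3 = encodePointer root
  site : ∀ (i : Fin D.numSites) (k : Fin 2), σ.realArr k i = D.site i k
  vertex : ∀ (j : Fin D.numVertices) (k : Fin 2), σ.realArr (2 + k) j = D.vertex j k
  vertexSite : ∀ (j : Fin D.numVertices) (k : Fin 3), σ.natArr k j = D.vertexSite j k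
  child : ∀ (j : Fin D.numVertices) (k : Fin 3), σ.natArr (3 + k) j = encodePointer (child j k)
  vertexEdge : ∀ (j : Fin D.numVertices) (k : Fin 3), σ.natArr (6 + k) j = D.vertexEdge j k
  edgeSite : ∀ (e : Fin D.numEdges) (k : Fin 2), σ.natArr (9 + k) e = D.edgeSite e k
  edgeEnd : ∀ (e : Fin D.numEdges) (k : Fin 2),
    σ.natArr (11 + k) e = encodePointer (D.edgeEnd e k)

/-- The real registers `0, 1` contain the coordinates of the centre and the real register `2`
contains the square of the radius of the smallest enclosing disk of `S`. -/
def HoldsSmallestEnclosingDisk (σ : State) (S : Finset Plane) : Prop :=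
  ∃ (c : Plane) (r : ℝ), IsSmallestEnclosingDisk S c r ∧
    σ.real 0 = c 0 ∧ σ.real 1 = c 1 ∧ σ.real 2 = r ^ 2

end RealRAM

end

/-! Write `LowerBound S c ρ` for the statement that every disk about `x` enclosing `S` has squared
radius at least `ρ + |x - c|²`. The extra term makes certificates rigid: a lower bound that also
encloses `S` is the smallest disk, with a unique centre (`LowerBound.add_le`,
`LowerBound.eq_of_isOptimal`). Any two points of `S` give a lower bound, the disk on the segment
between them (`lowerBound_mid`).

Let `v` be a vertex with defining points `p₁, p₂, p₃`. If their triangle is not obtuse, `v` is the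
centre sought (`DefinesVertex.isOptimal`). If it is obtuse at `p₃`, the candidate is the disk with
diameter `p₁p₂`. When that candidate is not optimal, the cone with apex `v` opposite to `p₁, p₂`
tells where to go on. The optimal centre is outside it. An edge that avoids `v` cannot cross its
boundary (`Outside.of_mem_edge`), because each boundary ray minus its apex lies in one cell only. Of
the edges at `v`, only the one defined by `p₁, p₂` can reach outside
(`DefinesVertex.edge_eq_of_outside`). Hence each piece left after removing `v` is wholly inside or
wholly outside, at most one is outside, and testing the child of a piece classifies the piece.

The target of the search is a `Terminal` vertex, one whose own candidate is optimal. Such a vertex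
is the optimal centre or shares an edge with it, so it is outside the cone of every obtuse vertex
with a non-optimal candidate (`Terminal.outside`). If a vertex is not terminal, following the edge
towards the midpoint leads to a neighbour with a smaller radius (`DefinesVertex.exists_next`). This
descent gives the existence of terminal vertices and also the connectedness of the graph; acyclicity
is not needed.

The search keeps the best lower bound met so far. Its invariant, maintained by
`SearchStep.invariant`, is that this bound is already optimal or the current subtree is connected
and contains a terminal vertex. Each round takes constant time and at least halves the subtree;
`numVertices_le` and `depth_le` make the number of rounds logarithmic. Without vertices, the first
edge or the only site already gives the answer (`firstBound_spec`). -/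

/-! ### Coordinates -/

/-- The squared Euclidean distance. -/
def sqDist (x y : Plane) : ℝ := (x 0 - y 0) ^ 2 + (x 1 - y 1) ^ 2

/-- The cross product of the vectors from `o` to `x` and to `y`. -/
def cross (o x y : Plane) : ℝ := (x 0 - o 0) * (y 1 - o 1) - (x 1 - o 1) * (y 0 - o 0)

theorem sqDist_nonneg (x y : Plane) : 0 ≤ sqDist x y := by unfold sqDist; positivity

theorem dist_eq_sqrt_sqDist (x y : Plane) : dist x y = √(sqDist x y) := by
  rw [EuclideanSpace.dist_eq, Fin.sum_univ_two, Real.dist_eq, Real.dist_eq, sq_abs, sq_abs, sqDist]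

theorem dist_le_dist_iff (x y z w : Plane) : dist x y ≤ dist z w ↔ sqDist x y ≤ sqDist z w := by
  rw [dist_eq_sqrt_sqDist, dist_eq_sqrt_sqDist, Real.sqrt_le_sqrt_iff (sqDist_nonneg _ _)]

theorem plane_ext {x y : Plane} (h0 : x 0 = y 0) (h1 : x 1 = y 1) : x = y := by
  ext i; fin_cases i <;> assumption

theorem eq_of_sqDist_nonpos {x y : Plane} (h : sqDist x y ≤ 0) : x = y := by
  unfold sqDist at h
  apply plane_ext <;> nlinarith [sq_nonneg (x 0 - y 0), sq_nonneg (x 1 - y 1)]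

theorem sqDist_pos {x y : Plane} (h : x ≠ y) : 0 < sqDist x y :=
  lt_of_not_ge fun h' => h (eq_of_sqDist_nonpos h')

theorem mem_fpvdCell {S : Finset Plane} {p q : Plane} :
    q ∈ fpvdCell S p ↔ ∀ p' ∈ S, sqDist q p' ≤ sqDist q p := by
  simp only [fpvdCell, Set.mem_ofPred_eq, dist_le_dist_iff]

theorem sqDist_eq_of_mem_fpvdCell {S : Finset Plane} {p q x : Plane} (hp : p ∈ S) (hq : q ∈ S)
    (hxp : x ∈ fpvdCell S p) (hxq : x ∈ fpvdCell S q) : sqDist x p = sqDist x q :=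
  le_antisymm (mem_fpvdCell.1 hxq p hp) (mem_fpvdCell.1 hxp q hq)

theorem mem_fpvdCell_of_sqDist_eq {S : Finset Plane} {p q x : Plane} (hxp : x ∈ fpvdCell S p)
    (h : sqDist x p = sqDist x q) : x ∈ fpvdCell S q :=
  mem_fpvdCell.2 fun p' hp' => h ▸ mem_fpvdCell.1 hxp p' hp'

/-- The point dividing the segment from `x` to `y` in the ratio `t : 1 - t`. -/
def between (x y : Plane) (t : ℝ) : Plane := x + t • (y - x)

@[simp] theorem between_apply (x y : Plane) (t : ℝ) (i : Fin 2) :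
    between x y t i = x i + t * (y i - x i) := by simp [between]

/-- The terms quadratic in `t` cancel, so the difference is affine along a segment. This is the
source of the convexity of cells and of all crossing arguments. -/
theorem sqDist_between_sub (x y p q : Plane) (t : ℝ) :
    sqDist (between x y t) q - sqDist (between x y t) p =
      (1 - t) * (sqDist x q - sqDist x p) + t * (sqDist y q - sqDist y p) := by
  simp only [sqDist, between_apply]; ring

theorem between_mem_fpvdCell {S : Finset Plane} {p x y : Plane} (hx : x ∈ fpvdCell S p)
    (hy : y ∈ fpvdCell S p) {t : ℝ} (h0 : 0 ≤ t) (h1 : t ≤ 1) : between x y t ∈ fpvdCell S p := by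
  rw [mem_fpvdCell] at *
  intro q hq
  have h := sqDist_between_sub x y p q t
  nlinarith [mul_nonneg (sub_nonneg.2 h1) (sub_nonneg.2 (hx q hq)),
    mul_nonneg h0 (sub_nonneg.2 (hy q hq))]

/-- A segment that leaves the cell of `p` meets another cell at the last point of the cell. -/
theorem exists_last_mem_fpvdCell {S : Finset Plane} {p x y : Plane} (hx : x ∈ fpvdCell S p)
    (hy : y ∉ fpvdCell S p) :
    ∃ t : ℝ, 0 ≤ t ∧ t < 1 ∧ ∃ q ∈ S, sqDist y p < sqDist y q ∧
      between x y t ∈ fpvdCell S p ∧ between x y t ∈ fpvdCell S q := by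
  classical
  rw [mem_fpvdCell] at hx hy
  push Not at hy
  obtain ⟨q₀, hq₀, hlt₀⟩ := hy
  -- For a point `q` that beats `p` at `y`, this is the parameter where the segment meets the
  -- bisector of `p` and `q`. The smallest such parameter marks the last point of the cell.
  let f : Plane → ℝ := fun q =>
    (sqDist x p - sqDist x q) / ((sqDist x p - sqDist x q) + (sqDist y q - sqDist y p))
  obtain ⟨q, hq, hmin⟩ := (S.filter fun q => sqDist y p < sqDist y q).exists_min_image f
    ⟨q₀, Finset.mem_filter.2 ⟨hq₀, hlt₀⟩⟩
  rw [Finset.mem_filter] at hq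
  have hden : ∀ q ∈ S, sqDist y p < sqDist y q →
      0 < (sqDist x p - sqDist x q) + (sqDist y q - sqDist y p) := fun q hq h => by
    linarith [hx q hq]
  have hf0 : 0 ≤ f q := div_nonneg (sub_nonneg.2 (hx q hq.1)) (hden q hq.1 hq.2).le
  have hf1 : f q < 1 := by
    rw [div_lt_one (hden q hq.1 hq.2)]; linarith [hq.2]
  have hcell : between x y (f q) ∈ fpvdCell S p := by
    rw [mem_fpvdCell]
    intro q' hq'
    have h := sqDist_between_sub x y p q' (f q)
    by_cases hlt : sqDist y p < sqDist y q'
    · have h1 := hmin q' (Finset.mem_filter.2 ⟨hq', hlt⟩)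
      have h2 : f q * ((sqDist x p - sqDist x q') + (sqDist y q' - sqDist y p)) ≤
          sqDist x p - sqDist x q' := by
        rw [← le_div_iff₀ (hden q' hq' hlt)]; exact h1
      linarith
    · nlinarith [mul_nonneg (sub_nonneg.2 hf1.le) (sub_nonneg.2 (hx q' hq')),
        mul_nonneg hf0 (sub_nonneg.2 (not_lt.1 hlt))]
  refine ⟨f q, hf0, hf1, q, hq.1, hq.2, hcell, mem_fpvdCell_of_sqDist_eq hcell ?_⟩
  have h := sqDist_between_sub x y p q (f q)
  have h2 : f q * ((sqDist x p - sqDist x q) + (sqDist y q - sqDist y p)) =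
      sqDist x p - sqDist x q := div_mul_cancel₀ _ (hden q hq.1 hq.2).ne'
  linarith

/-! ### Three points on a circle -/

theorem cross_sum_eq (v p₁ p₂ p₃ : Plane) :
    cross v p₁ p₂ + cross v p₂ p₃ + cross v p₃ p₁ = cross p₁ p₂ p₃ := by
  unfold cross; ring

/-- A line meets a circle in at most two points. -/
theorem cross_ne_zero_of_sqDist_eq {v p₁ p₂ p₃ : Plane} (h12 : p₁ ≠ p₂) (h13 : p₁ ≠ p₃)
    (h23 : p₂ ≠ p₃) (e12 : sqDist v p₁ = sqDist v p₂) (e13 : sqDist v p₁ = sqDist v p₃) :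
    cross p₁ p₂ p₃ ≠ 0 := by
  intro h
  have d12 := sqDist_pos h12
  have d13 := sqDist_pos h13
  have d23 := sqDist_pos h23
  unfold cross at h
  unfold sqDist at *
  obtain ⟨a, ha⟩ : ∃ a, a = p₂ 0 - p₁ 0 := ⟨_, rfl⟩
  obtain ⟨b, hb⟩ : ∃ b, b = p₂ 1 - p₁ 1 := ⟨_, rfl⟩
  obtain ⟨c, hc⟩ : ∃ c, c = p₃ 0 - p₁ 0 := ⟨_, rfl⟩
  obtain ⟨d, hd⟩ : ∃ d, d = p₃ 1 - p₁ 1 := ⟨_, rfl⟩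
  obtain ⟨x, hx⟩ : ∃ x, x = p₁ 0 - v 0 := ⟨_, rfl⟩
  obtain ⟨y, hy⟩ : ∃ y, y = p₁ 1 - v 1 := ⟨_, rfl⟩
  have E1 : 2 * (x * a + y * b) + (a ^ 2 + b ^ 2) = 0 := by subst_vars; linarith
  have E2 : 2 * (x * c + y * d) + (c ^ 2 + d ^ 2) = 0 := by subst_vars; linarith
  have hk : a * d = b * c := by subst_vars; linarith
  have D12 : 0 < a ^ 2 + b ^ 2 := by subst_vars; linarith
  have D13 : 0 < c ^ 2 + d ^ 2 := by subst_vars; linarith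
  have D23 : 0 < (c - a) ^ 2 + (d - b) ^ 2 := by subst_vars; linarith
  -- With `p₁` as origin, collinearity makes `(a, b)` a multiple of `(c, d)`, with factor the inner
  -- product over `c² + d²`. The circle equations then force this factor to be 0 or 1, that is `p₂ =
  -- p₁` or `p₂ = p₃`.
  have F1 : a * (c ^ 2 + d ^ 2) = c * (a * c + b * d) := by linear_combination d * hk
  have F2 : b * (c ^ 2 + d ^ 2) = d * (a * c + b * d) := by linear_combination -c * hk
  have F3 : (a * c + b * d) * ((a * c + b * d) - (c ^ 2 + d ^ 2)) = 0 := by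
    have : (a * c + b * d) ^ 2 = (a ^ 2 + b ^ 2) * (c ^ 2 + d ^ 2) := by
      linear_combination (-(a * d - b * c)) * hk
    linear_combination this + (c ^ 2 + d ^ 2) * E1 - (a * c + b * d) * E2 - 2 * x * F1 - 2 * y * F2
  rcases mul_eq_zero.1 F3 with h0 | h0
  · rw [h0, mul_zero] at F1 F2
    have ha0 := (mul_eq_zero.1 F1).resolve_right D13.ne'
    have hb0 := (mul_eq_zero.1 F2).resolve_right D13.ne'
    rw [ha0, hb0] at D12; norm_num at D12
  · have h0' : a * c + b * d = c ^ 2 + d ^ 2 := by linarith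
    rw [h0'] at F1 F2
    have ha0 := mul_right_cancel₀ D13.ne' F1
    have hb0 := mul_right_cancel₀ D13.ne' F2
    rw [ha0, hb0] at D23; norm_num at D23

/-- Uniqueness of the circumcentre by Cramer's rule: subtracting the equations for `v` and `w`
leaves a linear system for `v - w`. -/
theorem eq_of_sqDist_eq {v w p₁ p₂ p₃ : Plane} (h : cross p₁ p₂ p₃ ≠ 0)
    (e12 : sqDist v p₁ = sqDist v p₂) (e13 : sqDist v p₁ = sqDist v p₃)
    (f12 : sqDist w p₁ = sqDist w p₂) (f13 : sqDist w p₁ = sqDist w p₃) : v = w := by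
  unfold sqDist at *
  apply plane_ext <;> apply mul_left_cancel₀ h <;> unfold cross
  · linear_combination (-(p₃ 1 - p₁ 1) / 2) * (f12 - e12) + ((p₂ 1 - p₁ 1) / 2) * (f13 - e13)
  · linear_combination ((p₃ 0 - p₁ 0) / 2) * (f12 - e12) - ((p₂ 0 - p₁ 0) / 2) * (f13 - e13)

/-- Any common point of three cells is the circumcentre of the three sites, so the intersection is
automatically a singleton. -/
theorem definesVertex_of_mem {S : Finset Plane} {p₁ p₂ p₃ v : Plane} (m₁ : p₁ ∈ S) (m₂ : p₂ ∈ S)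
    (m₃ : p₃ ∈ S) (h12 : p₁ ≠ p₂) (h13 : p₁ ≠ p₃) (h23 : p₂ ≠ p₃) (c₁ : v ∈ fpvdCell S p₁)
    (c₂ : v ∈ fpvdCell S p₂) (c₃ : v ∈ fpvdCell S p₃) : DefinesVertex S p₁ p₂ p₃ v := by
  refine ⟨m₁, m₂, m₃, h12, h13, h23, Set.eq_singleton_iff_unique_mem.2 ⟨⟨⟨c₁, c₂⟩, c₃⟩, ?_⟩⟩
  rintro w ⟨⟨w₁, w₂⟩, w₃⟩
  have e12 := sqDist_eq_of_mem_fpvdCell m₁ m₂ c₁ c₂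
  have e13 := sqDist_eq_of_mem_fpvdCell m₁ m₃ c₁ c₃
  exact (eq_of_sqDist_eq (cross_ne_zero_of_sqDist_eq h12 h13 h23 e12 e13) e12 e13
    (sqDist_eq_of_mem_fpvdCell m₁ m₂ w₁ w₂) (sqDist_eq_of_mem_fpvdCell m₁ m₃ w₁ w₃)).symm

theorem DefinesVertex.mem {S : Finset Plane} {p₁ p₂ p₃ v : Plane} (h : DefinesVertex S p₁ p₂ p₃ v) :
    v ∈ fpvdCell S p₁ ∧ v ∈ fpvdCell S p₂ ∧ v ∈ fpvdCell S p₃ := by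
  have : v ∈ fpvdCell S p₁ ∩ fpvdCell S p₂ ∩ fpvdCell S p₃ := by rw [h.2.2.2.2.2.2]; rfl
  exact ⟨this.1.1, this.1.2, this.2⟩

theorem DefinesVertex.rotate {S : Finset Plane} {p₁ p₂ p₃ v : Plane}
    (h : DefinesVertex S p₁ p₂ p₃ v) : DefinesVertex S p₂ p₃ p₁ v := by
  have hm := h.mem
  obtain ⟨m₁, m₂, m₃, h12, h13, h23, -⟩ := h
  exact definesVertex_of_mem m₂ m₃ m₁ h23 h12.symm h13.symm hm.2.1 hm.2.2 hm.1

/-- In general position a vertex has no farthest points besides its three defining points. -/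
theorem DefinesVertex.eq_of_mem_fpvdCell {S : Finset Plane} (hS : InGeneralPosition S)
    {p₁ p₂ p₃ v q : Plane} (h : DefinesVertex S p₁ p₂ p₃ v) (hq : q ∈ S)
    (hvq : v ∈ fpvdCell S q) : q = p₁ ∨ q = p₂ ∨ q = p₃ := by
  classical
  by_contra! hne
  have hm := h.mem
  obtain ⟨m₁, m₂, m₃, h12, h13, h23, -⟩ := h
  refine hS {q, p₁, p₂, p₃} ?_ ?_ ⟨v, dist v q, ?_⟩
  · intro x hx
    simp only [Finset.mem_insert, Finset.mem_singleton] at hx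
    rcases hx with rfl | rfl | rfl | rfl <;> assumption
  · rw [Finset.card_insert_of_notMem, Finset.card_insert_of_notMem, Finset.card_pair h23] <;>
      simp [*]
  · intro x hx
    have hx' : x ∈ S ∧ v ∈ fpvdCell S x := by
      simp only [Finset.coe_insert, Finset.coe_singleton, Set.mem_insert_iff,
        Set.mem_singleton_iff] at hx
      rcases hx with rfl | rfl | rfl | rfl
      · exact ⟨hq, hvq⟩
      · exact ⟨m₁, hm.1⟩
      · exact ⟨m₂, hm.2.1⟩
      · exact ⟨m₃, hm.2.2⟩
    rw [dist_comm, dist_eq_sqrt_sqDist, dist_eq_sqrt_sqDist,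
      sqDist_eq_of_mem_fpvdCell hx'.1 hq hx'.2 hvq]

/-! ### Lower bounds and optimality -/

/-- Every disk that encloses `S` and has centre `x` has squared radius at least
`ρ + sqDist x c`. -/
def LowerBound (S : Finset Plane) (c : Plane) (ρ : ℝ) : Prop :=
  ∀ x, ∃ p ∈ S, ρ + sqDist x c ≤ sqDist x p

/-- The disk with centre `c` and squared radius `ρ` is certified to be the smallest enclosing
disk of `S`. -/
def IsOptimal (S : Finset Plane) (c : Plane) (ρ : ℝ) : Prop :=
  (∀ p ∈ S, sqDist c p ≤ ρ) ∧ LowerBound S c ρ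

theorem LowerBound.add_le {S : Finset Plane} {c c' : Plane} {ρ ρ' : ℝ} (h : LowerBound S c ρ)
    (h' : ∀ p ∈ S, sqDist c' p ≤ ρ') : ρ + sqDist c' c ≤ ρ' := by
  obtain ⟨p, hp, hle⟩ := h c'
  exact hle.trans (h' p hp)

theorem LowerBound.eq_of_isOptimal {S : Finset Plane} {c c' : Plane} {ρ ρ' : ℝ}
    (h : LowerBound S c ρ) (h' : IsOptimal S c' ρ') (hle : ρ' ≤ ρ) : c = c' ∧ ρ = ρ' := by
  have h1 := h.add_le h'.1
  have h2 := sqDist_nonneg c' c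
  exact ⟨(eq_of_sqDist_nonpos (by linarith)).symm, by linarith⟩

theorem IsOptimal.eq {S : Finset Plane} {c c' : Plane} {ρ ρ' : ℝ}
    (h : IsOptimal S c ρ) (h' : IsOptimal S c' ρ') : c = c' := by
  have h1 := h.2.add_le h'.1
  have h2 := h'.2.add_le h.1
  have h3 := sqDist_nonneg c c'
  exact (eq_of_sqDist_nonpos (by linarith)).symm

theorem IsOptimal.isSmallestEnclosingDisk {S : Finset Plane} (hS : S.Nonempty) {c : Plane} {ρ : ℝ}
    (h : IsOptimal S c ρ) : 0 ≤ ρ ∧ IsSmallestEnclosingDisk S c √ρ := by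
  obtain ⟨p₀, hp₀⟩ := hS
  refine ⟨(sqDist_nonneg _ _).trans (h.1 p₀ hp₀), Real.sqrt_nonneg _, ?_, ?_⟩
  · intro p hp
    rw [Metric.mem_closedBall, dist_comm, dist_eq_sqrt_sqDist]
    exact Real.sqrt_le_sqrt (h.1 p hp)
  · intro c' r' hc
    obtain ⟨p, hp, hle⟩ := h.2 c'
    have h1 := hc hp
    rw [Metric.mem_closedBall, dist_comm, dist_eq_sqrt_sqDist] at h1
    refine le_trans (Real.sqrt_le_sqrt ?_) h1
    linarith [sqDist_nonneg c' c]

/-- The midpoint of two points. -/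
noncomputable def mid (p q : Plane) : Plane := between p q (1 / 2)

theorem mid_comm (p q : Plane) : mid p q = mid q p := by
  apply plane_ext <;> simp [mid] <;> ring

theorem sqDist_mid_left (p q : Plane) : sqDist (mid p q) p = sqDist p q / 4 := by
  simp [mid, sqDist]; ring

theorem sqDist_mid_right (p q : Plane) : sqDist (mid p q) q = sqDist p q / 4 := by
  simp [mid, sqDist]; ring

/-- By Apollonius' theorem, the bound is the mean of the squared distances from `x` to `p` and `q`,
hence at most the larger one. -/
theorem lowerBound_mid {S : Finset Plane} {p q : Plane} (hp : p ∈ S) (hq : q ∈ S) :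
    LowerBound S (mid p q) (sqDist p q / 4) := by
  intro x
  have key : sqDist x p + sqDist x q = 2 * (sqDist p q / 4 + sqDist x (mid p q)) := by
    simp [mid, sqDist]; ring
  by_cases h : sqDist p q / 4 + sqDist x (mid p q) ≤ sqDist x p
  · exact ⟨p, hp, h⟩
  · exact ⟨q, hq, by linarith⟩

theorem isOptimal_mid_of_mem {S : Finset Plane} {p q : Plane} (hp : p ∈ S) (hq : q ∈ S)
    (h : mid p q ∈ fpvdCell S p) : IsOptimal S (mid p q) (sqDist p q / 4) :=
  ⟨fun x hx => (mem_fpvdCell.1 h x hx).trans_eq (sqDist_mid_left p q), lowerBound_mid hp hq⟩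

theorem IsOptimal.mid_mem {S : Finset Plane} {p q : Plane}
    (h : IsOptimal S (mid p q) (sqDist p q / 4)) :
    mid p q ∈ fpvdCell S p ∧ mid p q ∈ fpvdCell S q :=
  ⟨mem_fpvdCell.2 fun x hx => (h.1 x hx).trans_eq (sqDist_mid_left p q).symm,
    mem_fpvdCell.2 fun x hx => (h.1 x hx).trans_eq (sqDist_mid_right p q).symm⟩

/-! ### Vertices with acute and with obtuse triangles -/

/-- The line through `p₁` and `p₂` strictly separates `v` from `p₃`. If the three points are on a
circle around `v`, their triangle has an obtuse angle at `p₃`. -/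
def Obtuse (v p₁ p₂ p₃ : Plane) : Prop := cross v p₁ p₂ * cross p₁ p₂ p₃ < 0

/-- The point `x` is outside of the cone with apex `v` opposite to `p₁` and `p₂`. -/
def Outside (v p₁ p₂ x : Plane) : Prop :=
  0 < cross v p₁ p₂ * cross v x p₂ ∨ 0 < cross v p₁ p₂ * cross v p₁ x

theorem sqDist_expand (v x p : Plane) :
    sqDist x p = sqDist v p + sqDist x v
      - 2 * ((x 0 - v 0) * (p 0 - v 0) + (x 1 - v 1) * (p 1 - v 1)) := by
  unfold sqDist; ring

/-- A vertex in the triangle of its defining points is the optimal centre. -/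
theorem DefinesVertex.isOptimal {S : Finset Plane} {p₁ p₂ p₃ v : Plane}
    (h : DefinesVertex S p₁ p₂ p₃ v) (h3 : ¬ Obtuse v p₁ p₂ p₃) (h1 : ¬ Obtuse v p₂ p₃ p₁)
    (h2 : ¬ Obtuse v p₃ p₁ p₂) : IsOptimal S v (sqDist v p₁) := by
  have hm := h.mem
  obtain ⟨m₁, m₂, m₃, h12, h13, h23, -⟩ := h
  have e12 := sqDist_eq_of_mem_fpvdCell m₁ m₂ hm.1 hm.2.1
  have e13 := sqDist_eq_of_mem_fpvdCell m₁ m₃ hm.1 hm.2.2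
  have hk := cross_ne_zero_of_sqDist_eq h12 h13 h23 e12 e13
  refine ⟨mem_fpvdCell.1 hm.1, fun x => ?_⟩
  by_contra! hlt
  have l1 := hlt p₁ m₁
  have l2 := hlt p₂ m₂
  have l3 := hlt p₃ m₃
  rw [sqDist_expand v x] at l1 l2 l3
  rw [← e12] at l2
  rw [← e13] at l3
  unfold Obtuse at h1 h2 h3
  rw [← cross_sum_eq v p₁ p₂ p₃] at h3 hk
  rw [← cross_sum_eq v p₂ p₃ p₁] at h1
  rw [← cross_sum_eq v p₃ p₁ p₂] at h2
  obtain ⟨k12, hk12⟩ : ∃ k, k = cross v p₁ p₂ := ⟨_, rfl⟩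
  obtain ⟨k23, hk23⟩ : ∃ k, k = cross v p₂ p₃ := ⟨_, rfl⟩
  obtain ⟨k31, hk31⟩ : ∃ k, k = cross v p₃ p₁ := ⟨_, rfl⟩
  obtain ⟨d1, hd1⟩ : ∃ d, d = (x 0 - v 0) * (p₁ 0 - v 0) + (x 1 - v 1) * (p₁ 1 - v 1) := ⟨_, rfl⟩
  obtain ⟨d2, hd2⟩ : ∃ d, d = (x 0 - v 0) * (p₂ 0 - v 0) + (x 1 - v 1) * (p₂ 1 - v 1) := ⟨_, rfl⟩
  obtain ⟨d3, hd3⟩ : ∃ d, d = (x 0 - v 0) * (p₃ 0 - v 0) + (x 1 - v 1) * (p₃ 1 - v 1) := ⟨_, rfl⟩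
  -- The cross products are unnormalised barycentric coordinates of `v`. Non-obtuseness gives them
  -- all the sign of their sum `s`, while a better centre `x` would make all three inner products
  -- positive.
  have key : k23 * d1 + k31 * d2 + k12 * d3 = 0 := by
    rw [hk12, hk23, hk31, hd1, hd2, hd3]; unfold cross; ring
  rw [← hk12, ← hk23, ← hk31] at h1 h2 h3 hk
  rw [← hd1] at l1
  rw [← hd2] at l2
  rw [← hd3] at l3
  have q1 : 0 < d1 := by linarith
  have q2 : 0 < d2 := by linarith
  have q3 : 0 < d3 := by linarith
  obtain ⟨s, hs⟩ : ∃ s, s = k12 + k23 + k31 := ⟨_, rfl⟩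
  have s3 : 0 ≤ k12 * s := by rw [hs]; linarith
  have s1 : 0 ≤ k23 * s := by rw [hs]; linarith
  have s2 : 0 ≤ k31 * s := by rw [hs]; linarith
  rw [← hs] at hk
  have hpos : 0 < s * s := mul_self_pos.2 hk
  have hsum : k23 * s + k31 * s + k12 * s = s * s := by rw [hs]; ring
  have t : (k23 * s) * d1 + (k31 * s) * d2 + (k12 * s) * d3 = 0 := by linear_combination s * key
  have t1 := mul_nonneg s1 q1.le
  have t2 := mul_nonneg s2 q2.le
  have t3 := mul_nonneg s3 q3.le
  have z1 := (mul_eq_zero.1 (by linarith : (k23 * s) * d1 = 0)).resolve_right q1.ne'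
  have z2 := (mul_eq_zero.1 (by linarith : (k31 * s) * d2 = 0)).resolve_right q2.ne'
  have z3 := (mul_eq_zero.1 (by linarith : (k12 * s) * d3 = 0)).resolve_right q3.ne'
  linarith

/-- The squared norm of `αa + βb` is `R(α + β)² - 2αβ(R - a·b)`. If `α ≤ 0`, then `β > 0` and this
exceeds `R`. -/
theorem pos_of_on_circle {a₁ a₂ b₁ b₂ α β R : ℝ} (ha : a₁ ^ 2 + a₂ ^ 2 = R)
    (hb : b₁ ^ 2 + b₂ ^ 2 = R) (hs : a₁ * b₁ + a₂ * b₂ < R) (hR : 0 < R)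
    (hc : (α * a₁ + β * b₁) ^ 2 + (α * a₂ + β * b₂) ^ 2 = R) (h1 : 1 < α + β) : 0 < α := by
  by_contra! hα
  have hβ : 0 < β := by linarith
  have e : R * (α ^ 2 + β ^ 2 - 1) + 2 * (α * β) * (a₁ * b₁ + a₂ * b₂) = 0 := by
    linear_combination hc - α ^ 2 * ha - β ^ 2 * hb
  have h2 : 0 ≤ (-α * β) * (R - (a₁ * b₁ + a₂ * b₂)) :=
    mul_nonneg (mul_nonneg (by linarith) hβ.le) (by linarith)
  have h3 : 0 < R * ((α + β) ^ 2 - 1) := mul_pos hR (by nlinarith)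
  nlinarith

/-! ### Geometry of the cone at an obtuse vertex -/

section Obtuse

variable {v p₁ p₂ p₃ : Plane}

theorem Obtuse.swap (h : Obtuse v p₁ p₂ p₃) : Obtuse v p₂ p₁ p₃ := by
  unfold Obtuse cross at *; linarith

theorem Outside.swap {x : Plane} (h : Outside v p₁ p₂ x) : Outside v p₂ p₁ x := by
  unfold Outside cross at *
  exact h.symm.imp (fun h => by linarith) fun h => by linarith

theorem Obtuse.cross_ne_zero (h : Obtuse v p₁ p₂ p₃) : cross v p₁ p₂ ≠ 0 := by
  intro h0; rw [Obtuse, h0, zero_mul] at h; exact lt_irrefl _ h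

theorem Obtuse.mid_ne (h : Obtuse v p₁ p₂ p₃) : mid p₁ p₂ ≠ v := by
  rintro rfl
  apply h.cross_ne_zero
  simp [cross, mid]; ring

/-- The inner product of the vectors to two points of a circle with centre `v` that are not
antipodal. -/
theorem abs_inner_lt (hk : cross v p₁ p₂ ≠ 0) (e12 : sqDist v p₁ = sqDist v p₂) :
    |(p₁ 0 - v 0) * (p₂ 0 - v 0) + (p₁ 1 - v 1) * (p₂ 1 - v 1)| < sqDist v p₁ := by
  apply abs_lt_of_sq_lt_sq _ (sqDist_nonneg _ _)
  have h := sq_pos_of_ne_zero hk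
  have : ((p₁ 0 - v 0) * (p₂ 0 - v 0) + (p₁ 1 - v 1) * (p₂ 1 - v 1)) ^ 2 + cross v p₁ p₂ ^ 2 =
      sqDist v p₁ * sqDist v p₂ := by unfold cross sqDist; ring
  rw [← e12] at this
  linarith

/-- Cramer's rule in the basis `p₁ - v, p₂ - v`. The coefficient sum exceeds 1 because `p₃` is
beyond the chord `p₁p₂`, and on the circle this forces `p₃` onto the arc between `p₁` and `p₂`. -/
theorem Obtuse.exists_coeff (h : Obtuse v p₁ p₂ p₃) (e12 : sqDist v p₁ = sqDist v p₂)
    (e13 : sqDist v p₁ = sqDist v p₃) :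
    ∃ α β : ℝ, 0 < α ∧ 0 < β ∧ 1 < α + β ∧
      p₃ 0 - v 0 = α * (p₁ 0 - v 0) + β * (p₂ 0 - v 0) ∧
      p₃ 1 - v 1 = α * (p₁ 1 - v 1) + β * (p₂ 1 - v 1) := by
  have hk := h.cross_ne_zero
  have hs := abs_lt.1 (abs_inner_lt hk e12)
  have hR : 0 < sqDist v p₁ := by linarith [hs.1, hs.2]
  have x0 : p₃ 0 - v 0 = -cross v p₂ p₃ / cross v p₁ p₂ * (p₁ 0 - v 0) +
      -cross v p₃ p₁ / cross v p₁ p₂ * (p₂ 0 - v 0) := by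
    field_simp; unfold cross; ring
  have x1 : p₃ 1 - v 1 = -cross v p₂ p₃ / cross v p₁ p₂ * (p₁ 1 - v 1) +
      -cross v p₃ p₁ / cross v p₁ p₂ * (p₂ 1 - v 1) := by
    field_simp; unfold cross; ring
  have hsum : 1 < -cross v p₂ p₃ / cross v p₁ p₂ + -cross v p₃ p₁ / cross v p₁ p₂ := by
    have e : -cross v p₂ p₃ / cross v p₁ p₂ + -cross v p₃ p₁ / cross v p₁ p₂ =
        1 - cross v p₁ p₂ * cross p₁ p₂ p₃ / cross v p₁ p₂ ^ 2 := by
      rw [← cross_sum_eq v p₁ p₂ p₃]; field_simp; ring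
    have : cross v p₁ p₂ * cross p₁ p₂ p₃ / cross v p₁ p₂ ^ 2 < 0 :=
      div_neg_of_neg_of_pos h (sq_pos_of_ne_zero hk)
    linarith
  have ha : (p₁ 0 - v 0) ^ 2 + (p₁ 1 - v 1) ^ 2 = sqDist v p₁ := by unfold sqDist; ring
  have hb : (p₂ 0 - v 0) ^ 2 + (p₂ 1 - v 1) ^ 2 = sqDist v p₁ := by rw [e12]; unfold sqDist; ring
  have hc : (p₃ 0 - v 0) ^ 2 + (p₃ 1 - v 1) ^ 2 = sqDist v p₁ := by rw [e13]; unfold sqDist; ring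
  rw [x0, x1] at hc
  refine ⟨_, _, pos_of_on_circle ha hb hs.2 hR hc hsum,
    pos_of_on_circle (β := -cross v p₂ p₃ / cross v p₁ p₂) hb ha ?_ hR ?_ ?_, hsum, x0, x1⟩
  · linarith [hs.2]
  · rw [← hc]; ring
  · rwa [add_comm]

/-- Thales: a point that sees `p₁p₂` under an obtuse angle is strictly inside the circle with that
diameter. -/
theorem Obtuse.sqDist_mid_lt (h : Obtuse v p₁ p₂ p₃) (e12 : sqDist v p₁ = sqDist v p₂)
    (e13 : sqDist v p₁ = sqDist v p₃) : sqDist (mid p₁ p₂) p₃ < sqDist (mid p₁ p₂) p₁ := by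
  obtain ⟨α, β, -, -, hsum, x0, x1⟩ := h.exists_coeff e12 e13
  have hs := abs_lt.1 (abs_inner_lt h.cross_ne_zero e12)
  rw [sqDist_expand v _ p₃, sqDist_expand v _ p₁, ← e13, x0, x1]
  have m0 : mid p₁ p₂ 0 - v 0 = ((p₁ 0 - v 0) + (p₂ 0 - v 0)) / 2 := by simp [mid]; ring
  have m1 : mid p₁ p₂ 1 - v 1 = ((p₁ 1 - v 1) + (p₂ 1 - v 1)) / 2 := by simp [mid]; ring
  rw [m0, m1]
  have hp : 0 < (α + β - 1) * (sqDist v p₁ + ((p₁ 0 - v 0) * (p₂ 0 - v 0) +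
    (p₁ 1 - v 1) * (p₂ 1 - v 1))) := mul_pos (by linarith) (by linarith [hs.1])
  have ha : sqDist v p₁ = (p₁ 0 - v 0) ^ 2 + (p₁ 1 - v 1) ^ 2 := by unfold sqDist; ring
  have hb : sqDist v p₁ = (p₂ 0 - v 0) ^ 2 + (p₂ 1 - v 1) ^ 2 := by rw [e12]; unfold sqDist; ring
  -- The split lets the squared radius be written as `|p₁ - v|²` in one summand and as `|p₂ - v|²`
  -- in the other, matching the inner products with the midpoint.
  have hp' : 0 < (α - 1) * (sqDist v p₁ + ((p₁ 0 - v 0) * (p₂ 0 - v 0) +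
    (p₁ 1 - v 1) * (p₂ 1 - v 1))) + β * (sqDist v p₁ + ((p₁ 0 - v 0) * (p₂ 0 - v 0) +
    (p₁ 1 - v 1) * (p₂ 1 - v 1))) := by linarith
  nth_rewrite 2 [hb] at hp'
  nth_rewrite 1 [ha] at hp'
  linarith

/-- A Binet–Cauchy identity. It turns the cone test into inner products, which `sqDist_expand`
relates to distances. -/
theorem cross_mul_cross_left (v p q x : Plane) : cross v p q * cross v x q =
    sqDist v q * ((x 0 - v 0) * (p 0 - v 0) + (x 1 - v 1) * (p 1 - v 1)) -
      ((p 0 - v 0) * (q 0 - v 0) + (p 1 - v 1) * (q 1 - v 1)) *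
        ((x 0 - v 0) * (q 0 - v 0) + (x 1 - v 1) * (q 1 - v 1)) := by
  unfold cross sqDist; ring

theorem cross_mul_cross_right (v p q x : Plane) : cross v p q * cross v p x =
    sqDist v p * ((x 0 - v 0) * (q 0 - v 0) + (x 1 - v 1) * (q 1 - v 1)) -
      ((p 0 - v 0) * (q 0 - v 0) + (p 1 - v 1) * (q 1 - v 1)) *
        ((x 0 - v 0) * (p 0 - v 0) + (x 1 - v 1) * (p 1 - v 1)) := by
  unfold cross sqDist; ring

/-- In the cone opposite to `p₁` and `p₂`, one of these points is farther away than from `v`. -/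
theorem exists_le_sqDist_of_not_outside {x : Plane} (hk : cross v p₁ p₂ ≠ 0)
    (e12 : sqDist v p₁ = sqDist v p₂) (hx : ¬ Outside v p₁ p₂ x) :
    sqDist v p₁ + sqDist x v ≤ sqDist x p₁ ∨ sqDist v p₁ + sqDist x v ≤ sqDist x p₂ := by
  have hs := abs_lt.1 (abs_inner_lt hk e12)
  unfold Outside at hx
  rw [cross_mul_cross_left, cross_mul_cross_right, ← e12] at hx
  push Not at hx
  obtain ⟨hx1, hx2⟩ := hx
  rw [sqDist_expand v x p₁, sqDist_expand v x p₂, ← e12]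
  by_contra! hc
  -- Adding `hx1` and `hx2` gives `(R - s)(D₁ + D₂) ≤ 0`, where `D₁, D₂` are the inner products with
  -- `x - v` and `s < R` is that of `p₁ - v` and `p₂ - v`.
  nlinarith [mul_pos (sub_pos.2 hs.2) (by linarith :
    0 < ((x 0 - v 0) * (p₁ 0 - v 0) + (x 1 - v 1) * (p₁ 1 - v 1)) +
      ((x 0 - v 0) * (p₂ 0 - v 0) + (x 1 - v 1) * (p₂ 1 - v 1)))]

/-- The edge at `v` with defining points `p₁` and `p₃` is in the cone opposite to `p₁`, `p₂`. -/
theorem Obtuse.not_outside {x : Plane} (h : Obtuse v p₁ p₂ p₃) (e12 : sqDist v p₁ = sqDist v p₂)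
    (e13 : sqDist v p₁ = sqDist v p₃) (hx3 : sqDist x p₁ = sqDist x p₃)
    (hx2 : sqDist x p₂ ≤ sqDist x p₁) : ¬ Outside v p₁ p₂ x := by
  obtain ⟨α, β, hα, hβ, hsum, x0, x1⟩ := h.exists_coeff e12 e13
  have hs := abs_lt.1 (abs_inner_lt h.cross_ne_zero e12)
  rw [sqDist_expand v x p₁, sqDist_expand v x p₃, ← e13, x0, x1] at hx3
  rw [sqDist_expand v x p₁, sqDist_expand v x p₂, ← e12] at hx2
  unfold Outside
  rw [cross_mul_cross_left, cross_mul_cross_right, ← e12]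
  -- The left side is the inner product of `p₁ - v` and `p₃ - v`, two vectors of equal length.
  have hcs : α * sqDist v p₁ + β * ((p₁ 0 - v 0) * (p₂ 0 - v 0) + (p₁ 1 - v 1) * (p₂ 1 - v 1)) ≤
      sqDist v p₁ := by
    have : sqDist v p₁ + sqDist v p₃ - 2 * (α * sqDist v p₁ +
        β * ((p₁ 0 - v 0) * (p₂ 0 - v 0) + (p₁ 1 - v 1) * (p₂ 1 - v 1))) = sqDist p₁ p₃ := by
      rw [sqDist_expand v p₁ p₃, x0, x1]; unfold sqDist; ring
    linarith [sqDist_nonneg p₁ p₃]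
  generalize hD1 : (x 0 - v 0) * (p₁ 0 - v 0) + (x 1 - v 1) * (p₁ 1 - v 1) = D1 at *
  generalize hD2 : (x 0 - v 0) * (p₂ 0 - v 0) + (x 1 - v 1) * (p₂ 1 - v 1) = D2 at *
  generalize (p₁ 0 - v 0) * (p₂ 0 - v 0) + (p₁ 1 - v 1) * (p₂ 1 - v 1) = s at *
  generalize sqDist v p₁ = R at *
  have hD : D1 = α * D1 + β * D2 := by
    rw [← hD1, ← hD2]; linarith
  have hle : D1 ≤ D2 := by linarith
  -- If `D1` were positive, `hD` and `hle` would give `D1 ≥ (α + β) D1 > D1`.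
  have hneg : D1 ≤ 0 := by nlinarith
  have k2 : R * D2 ≤ s * D1 := by
    have e : β * (R * D2 - s * D1) = D1 * (R - (α * R + β * s)) := by linear_combination (-R) * hD
    have : β * (R * D2 - s * D1) ≤ 0 := by
      rw [e]; exact mul_nonpos_of_nonpos_of_nonneg hneg (by linarith)
    by_contra! hc
    nlinarith [mul_pos hβ (sub_pos.2 hc)]
  have k1 : R * D1 ≤ s * D2 := by
    nlinarith [mul_nonneg (by linarith [hs.1] : 0 ≤ R + s) (sub_nonneg.2 hle)]
  rintro (hc | hc) <;> linarith

end Obtuse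

/-- The half-line from `v` away from a farthest point `p` is in the interior of the cell of `p`. -/
theorem eq_of_mem_fpvdCell_opposite {S : Finset Plane} {v p q z : Plane} {b : ℝ} (hb : 0 < b)
    (hp : p ∈ S) (hq : q ∈ S) (hv : v ∈ fpvdCell S p) (hz : z ∈ fpvdCell S q)
    (z0 : z 0 - v 0 = -b * (p 0 - v 0)) (z1 : z 1 - v 1 = -b * (p 1 - v 1)) : q = p := by
  have h1 := mem_fpvdCell.1 hv q hq
  have h2 := mem_fpvdCell.1 hz p hp
  have e : sqDist z p - sqDist z q = b * sqDist q p + (1 + b) * (sqDist v p - sqDist v q) := by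
    rw [sqDist_expand v z p, sqDist_expand v z q, z0, z1]; unfold sqDist; ring
  apply eq_of_sqDist_nonpos
  by_contra! hc
  nlinarith [mul_pos hb hc, mul_nonneg (by linarith : 0 ≤ 1 + b) (sub_nonneg.2 h1)]

/-- A vanishing cross product puts `x` on the line through `v` and `p₂`, and the sign condition
selects the half opposite to `p₂`, which is a boundary ray of the cone. -/
theorem exists_opposite {v p₁ p₂ x : Plane} (hk : cross v p₁ p₂ ≠ 0)
    (h1 : cross v p₁ p₂ * cross v x p₂ = 0) (h2 : cross v p₁ p₂ * cross v p₁ x ≤ 0) :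
    ∃ b : ℝ, 0 ≤ b ∧ x 0 - v 0 = -b * (p₂ 0 - v 0) ∧ x 1 - v 1 = -b * (p₂ 1 - v 1) := by
  have h1' := (mul_eq_zero.1 h1).resolve_left hk
  refine ⟨-(cross v p₁ p₂ * cross v p₁ x) / cross v p₁ p₂ ^ 2,
    div_nonneg (by linarith) (sq_nonneg _), ?_, ?_⟩
  · field_simp
    unfold cross at *
    linear_combination (p₁ 0 - v 0) * h1'
  · field_simp
    unfold cross at *
    linear_combination (p₁ 1 - v 1) * h1'

/-- An edge that does not contain `v` does not cross the boundary of the cone opposite to two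
farthest points of `v`. -/
theorem Outside.of_mem_edge {S : Finset Plane} {v p₁ p₂ a b x y : Plane} (hk : cross v p₁ p₂ ≠ 0)
    (m₁ : p₁ ∈ S) (m₂ : p₂ ∈ S) (c₁ : v ∈ fpvdCell S p₁) (c₂ : v ∈ fpvdCell S p₂)
    (ma : a ∈ S) (mb : b ∈ S) (hab : a ≠ b) (hx : x ∈ fpvdCell S a ∩ fpvdCell S b)
    (hy : y ∈ fpvdCell S a ∩ fpvdCell S b) (hv : v ∉ fpvdCell S a ∩ fpvdCell S b)
    (hout : Outside v p₁ p₂ x) : Outside v p₁ p₂ y := by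
  by_contra hin
  unfold Outside at hin hout
  push Not at hin
  -- Being outside means that this maximum is positive, so a crossing yields a zero of `φ`, a point
  -- of the edge on a boundary ray.
  let φ : ℝ → ℝ := fun t => max (cross v p₁ p₂ * cross v (between x y t) p₂)
    (cross v p₁ p₂ * cross v p₁ (between x y t))
  have hφ : ContinuousOn φ (Set.Icc 0 1) := by
    apply Continuous.continuousOn
    simp only [φ, cross, between_apply]
    fun_prop
  have b0 : between x y 0 = x := by simp [between]
  have b1 : between x y 1 = y := by simp [between]
  obtain ⟨t, ⟨t0, t1⟩, ht⟩ : (0 : ℝ) ∈ φ '' Set.Icc 0 1 := by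
    apply intermediate_value_Icc' zero_le_one hφ
    simp only [φ, b0, b1, Set.mem_Icc, max_le_iff, le_max_iff]
    exact ⟨hin, hout.imp le_of_lt le_of_lt⟩
  have hz : between x y t ∈ fpvdCell S a ∩ fpvdCell S b :=
    ⟨between_mem_fpvdCell hx.1 hy.1 t0 t1, between_mem_fpvdCell hx.2 hy.2 t0 t1⟩
  have hin1 : cross v p₁ p₂ * cross v (between x y t) p₂ ≤ 0 := ht ▸ le_max_left _ _
  have hin2 : cross v p₁ p₂ * cross v p₁ (between x y t) ≤ 0 := ht ▸ le_max_right _ _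
  simp only [φ] at ht
  generalize between x y t = z at hz hin1 hin2 ht
  -- The apex is not on the edge, and any other point of the ray is in the cell of `p` alone,
  -- whereas `z` is in two different cells.
  have key : ∀ p ∈ S, v ∈ fpvdCell S p → ¬ ∃ b : ℝ, 0 ≤ b ∧ z 0 - v 0 = -b * (p 0 - v 0) ∧
      z 1 - v 1 = -b * (p 1 - v 1) := by
    rintro p hp hvp ⟨b', hb', z0, z1⟩
    rcases hb'.eq_or_lt with rfl | hpos
    · apply hv
      have : v = z := plane_ext (by linarith) (by linarith)
      rwa [this]
    · exact hab ((eq_of_mem_fpvdCell_opposite hpos hp ma hvp hz.1 z0 z1).trans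
        (eq_of_mem_fpvdCell_opposite hpos hp mb hvp hz.2 z0 z1).symm)
  rcases max_choice (cross v p₁ p₂ * cross v z p₂) (cross v p₁ p₂ * cross v p₁ z) with hmax | hmax
  · exact key p₂ m₂ c₂ (exists_opposite hk (hmax.symm.trans ht) hin2)
  · have hneg : cross v p₂ p₁ = -cross v p₁ p₂ := by unfold cross; ring
    refine key p₁ m₁ c₁ (exists_opposite (v := v) (p₁ := p₂) (by rwa [hneg, neg_ne_zero]) ?_ ?_)
    · rw [← hmax.symm.trans ht]; unfold cross; ring
    · refine le_trans (le_of_eq ?_) hin1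
      unfold cross; ring

/-! ### Terminal vertices -/

/-- If the triangle of the vertex `v` is obtuse, the midpoint of its longest side is the optimal
centre. -/
def Terminal (S : Finset Plane) (v : Plane) : Prop :=
  ∀ p₁ p₂ p₃, DefinesVertex S p₁ p₂ p₃ v → Obtuse v p₁ p₂ p₃ →
    IsOptimal S (mid p₁ p₂) (sqDist p₁ p₂ / 4)

theorem DefinesVertex.sqDist_eq {S : Finset Plane} {p₁ p₂ p₃ v : Plane}
    (h : DefinesVertex S p₁ p₂ p₃ v) :
    sqDist v p₁ = sqDist v p₂ ∧ sqDist v p₁ = sqDist v p₃ :=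
  ⟨sqDist_eq_of_mem_fpvdCell h.1 h.2.1 h.mem.1 h.mem.2.1,
    sqDist_eq_of_mem_fpvdCell h.1 h.2.2.1 h.mem.1 h.mem.2.2⟩

/-- A terminal vertex is the optimal centre or on an edge with the optimal centre. -/
theorem Terminal.exists_isOptimal {S : Finset Plane} {v q₁ q₂ q₃ : Plane} (h : Terminal S v)
    (hv : DefinesVertex S q₁ q₂ q₃ v) :
    ∃ c ρ, IsOptimal S c ρ ∧ (c = v ∨ ∃ a b, DefinesEdge S a b ∧ c = mid a b ∧
      v ∈ fpvdCell S a ∩ fpvdCell S b ∧ c ∈ fpvdCell S a ∩ fpvdCell S b) := by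
  by_cases hob : ∃ p₁ p₂ p₃, DefinesVertex S p₁ p₂ p₃ v ∧ Obtuse v p₁ p₂ p₃
  · obtain ⟨p₁, p₂, p₃, hd, ho⟩ := hob
    have hopt := h p₁ p₂ p₃ hd ho
    have hm := hopt.mid_mem
    exact ⟨_, _, hopt, .inr ⟨p₁, p₂, ⟨hd.1, hd.2.1, hd.2.2.2.1, _, hm, v,
      ⟨hd.mem.1, hd.mem.2.1⟩, ho.mid_ne⟩, rfl, ⟨hd.mem.1, hd.mem.2.1⟩, hm⟩⟩
  · push Not at hob
    exact ⟨v, _, hv.isOptimal (hob _ _ _ hv) (hob _ _ _ hv.rotate) (hob _ _ _ hv.rotate.rotate),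
      .inl rfl⟩

/-- Pythagoras on the bisector: the distance to the midpoint shrinks by the factor `1 - t`, and `1 -
(1 - t)² = t(2 - t)`. -/
theorem sqDist_between_mid {v p₁ p₂ : Plane} (e12 : sqDist v p₁ = sqDist v p₂) (t : ℝ) :
    sqDist (between v (mid p₁ p₂) t) p₁ =
      sqDist v p₁ - t * (2 - t) * sqDist v (mid p₁ p₂) := by
  simp only [sqDist, mid, between_apply] at *
  linear_combination (-t / 2) * e12

/-- If the midpoint of the longest side is not the optimal centre, the edge towards it ends at a
vertex with a smaller enclosing disk. -/
theorem DefinesVertex.exists_next {S : Finset Plane} (hS : InGeneralPosition S)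
    {v p₁ p₂ p₃ : Plane} (hv : DefinesVertex S p₁ p₂ p₃ v) (ho : Obtuse v p₁ p₂ p₃)
    (hn : ¬ IsOptimal S (mid p₁ p₂) (sqDist p₁ p₂ / 4)) :
    ∃ z q, DefinesVertex S p₁ p₂ q z ∧ z ≠ v ∧ sqDist z p₁ < sqDist v p₁ := by
  have hm := hv.mem
  obtain ⟨e12, e13⟩ := hv.sqDist_eq
  have hlt := ho.sqDist_mid_lt e12 e13
  obtain ⟨t, t0, t1, q, hq, hqlt, z₁, zq⟩ := exists_last_mem_fpvdCell hm.1
    (fun h => hn (isOptimal_mid_of_mem hv.1 hv.2.1 h))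
  have hmid : sqDist (mid p₁ p₂) p₂ = sqDist (mid p₁ p₂) p₁ := by
    rw [sqDist_mid_left, sqDist_mid_right]
  have z₂ : between v (mid p₁ p₂) t ∈ fpvdCell S p₂ := by
    apply mem_fpvdCell_of_sqDist_eq z₁
    have := sqDist_between_sub v (mid p₁ p₂) p₁ p₂ t
    rw [hmid, e12] at this
    linarith
  have hq1 : p₁ ≠ q := by rintro rfl; exact lt_irrefl _ hqlt
  have hq2 : p₂ ≠ q := by rintro rfl; exact absurd hqlt (by rw [hmid]; exact lt_irrefl _)
  -- If the move had length zero, `q` would be farthest from `v`, hence `p₃` by general position.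
  -- But `p₃` is closer to the midpoint than `p₁` is, unlike `q`.
  have hne : between v (mid p₁ p₂) t ≠ v := by
    intro h
    rw [h] at zq
    rcases hv.eq_of_mem_fpvdCell hS hq zq with rfl | rfl | rfl
    · exact hq1 rfl
    · exact hq2 rfl
    · exact lt_asymm hlt hqlt
  refine ⟨_, q, definesVertex_of_mem hv.1 hv.2.1 hq hv.2.2.2.1 hq1 hq2 z₁ z₂ zq, hne, ?_⟩
  have tpos : 0 < t := by
    rcases t0.eq_or_lt with rfl | h
    · exact absurd (by simp [between]) hne
    · exact h
  rw [sqDist_between_mid e12]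
  have := mul_pos (mul_pos tpos (by linarith : 0 < 2 - t)) (sqDist_pos ho.mid_ne.symm)
  linarith

/-- At a vertex whose candidate is not optimal, the optimal centre is outside of the cone. -/
theorem DefinesVertex.outside_of_isOptimal {S : Finset Plane} {v p₁ p₂ p₃ c : Plane} {ρ : ℝ}
    (hv : DefinesVertex S p₁ p₂ p₃ v) (ho : Obtuse v p₁ p₂ p₃) (hc : IsOptimal S c ρ) :
    c = v ∨ Outside v p₁ p₂ c := by
  by_contra! h
  -- With `R = sqDist v p₁`, a centre `c ≠ v` in the cone would satisfy both `R + |c - v|² ≤ ρ` and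
  -- `ρ + |c - v|² ≤ R`.
  have h1 := exists_le_sqDist_of_not_outside ho.cross_ne_zero hv.sqDist_eq.1 h.2
  have h2 : ρ + sqDist v c ≤ sqDist v p₁ := hc.2.add_le (mem_fpvdCell.1 hv.mem.1)
  have h3 := sqDist_pos h.1
  have h4 := sqDist_nonneg v c
  rcases h1 with h1 | h1
  · linarith [hc.1 p₁ hv.1]
  · linarith [hc.1 p₂ hv.2.1]

/-- Either the midpoint is the unique optimal centre, and it differs from `v`, or a neighbouring
vertex has a smaller enclosing disk. -/
theorem DefinesVertex.not_isOptimal_of_obtuse {S : Finset Plane} {v p₁ p₂ p₃ : Plane} {ρ : ℝ}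
    (hS : InGeneralPosition S) (hv : DefinesVertex S p₁ p₂ p₃ v) (ho : Obtuse v p₁ p₂ p₃) :
    ¬ IsOptimal S v ρ := by
  intro hopt
  by_cases hn : IsOptimal S (mid p₁ p₂) (sqDist p₁ p₂ / 4)
  · exact ho.mid_ne (hn.eq hopt)
  · obtain ⟨z, q, hz, hne, hlt⟩ := hv.exists_next hS ho hn
    have h1 := hopt.2.add_le (mem_fpvdCell.1 hz.mem.1)
    have h2 := hopt.1 p₁ hv.1
    linarith [sqDist_nonneg z v]

/-- An edge at `v` that contains a point outside of the cone is the one defined by `p₁`, `p₂`. -/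
theorem DefinesVertex.edge_eq_of_outside {S : Finset Plane} (hS : InGeneralPosition S)
    {v p₁ p₂ p₃ a b x : Plane} (hv : DefinesVertex S p₁ p₂ p₃ v) (ho : Obtuse v p₁ p₂ p₃)
    (hab : DefinesEdge S a b) (hvab : v ∈ fpvdCell S a ∩ fpvdCell S b)
    (hx : x ∈ fpvdCell S a ∩ fpvdCell S b) (hout : Outside v p₁ p₂ x) :
    (a = p₁ ∧ b = p₂) ∨ (a = p₂ ∧ b = p₁) := by
  obtain ⟨ma, mb, hne, -⟩ := hab
  obtain ⟨m₁, m₂, m₃, -⟩ := id hv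
  obtain ⟨e12, e13⟩ := hv.sqDist_eq
  have h13 : x ∈ fpvdCell S p₁ → x ∈ fpvdCell S p₃ → False := fun c₁ c₃ =>
    ho.not_outside e12 e13 (sqDist_eq_of_mem_fpvdCell m₁ m₃ c₁ c₃) (mem_fpvdCell.1 c₁ p₂ m₂) hout
  have h23 : x ∈ fpvdCell S p₂ → x ∈ fpvdCell S p₃ → False := fun c₂ c₃ =>
    ho.swap.not_outside e12.symm (e12.symm.trans e13) (sqDist_eq_of_mem_fpvdCell m₂ m₃ c₂ c₃)
      (mem_fpvdCell.1 c₂ p₁ m₁) hout.swap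
  rcases hv.eq_of_mem_fpvdCell hS ma hvab.1 with rfl | rfl | rfl <;>
  rcases hv.eq_of_mem_fpvdCell hS mb hvab.2 with rfl | rfl | rfl <;>
  first
  | exact absurd rfl hne
  | exact .inl ⟨rfl, rfl⟩
  | exact .inr ⟨rfl, rfl⟩
  | exact (h13 hx.1 hx.2).elim
  | exact (h13 hx.2 hx.1).elim
  | exact (h23 hx.1 hx.2).elim
  | exact (h23 hx.2 hx.1).elim

/-- Terminal vertices are outside of the cone of a vertex whose candidate is not optimal. -/
theorem Terminal.outside {S : Finset Plane} (hS : InGeneralPosition S)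
    {v p₁ p₂ p₃ w q₁ q₂ q₃ : Plane} (hv : DefinesVertex S p₁ p₂ p₃ v) (ho : Obtuse v p₁ p₂ p₃)
    (hn : ¬ IsOptimal S (mid p₁ p₂) (sqDist p₁ p₂ / 4)) (hw : DefinesVertex S q₁ q₂ q₃ w)
    (ht : Terminal S w) : Outside v p₁ p₂ w := by
  obtain ⟨c, ρ, hc, hcw⟩ := ht.exists_isOptimal hw
  have hcv : Outside v p₁ p₂ c := (hv.outside_of_isOptimal ho hc).resolve_left
    fun h => hv.not_isOptimal_of_obtuse hS ho (h ▸ hc)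
  rcases hcw with rfl | ⟨a, b, hab, rfl, hwab, hcab⟩
  · exact hcv
  -- If the edge of the optimal centre passed through `v`, it would be the one defined by `p₁, p₂`,
  -- making the candidate of `v` optimal. Otherwise being outside carries over from the centre to
  -- `w` along the edge.
  by_cases hvab : v ∈ fpvdCell S a ∩ fpvdCell S b
  · rcases hv.edge_eq_of_outside hS ho hab hvab hcab hcv with ⟨rfl, rfl⟩ | ⟨rfl, rfl⟩
    · exact (hn (isOptimal_mid_of_mem hv.1 hv.2.1 hcab.1)).elim
    · rw [mid_comm] at hcab
      exact (hn (isOptimal_mid_of_mem hv.1 hv.2.1 hcab.2)).elim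
  · exact hcv.of_mem_edge ho.cross_ne_zero hv.1 hv.2.1 hv.mem.1 hv.mem.2.1 hab.1 hab.2.1 hab.2.2.1
      hcab hwab hvab

/-! ### The graph of the diagram -/

namespace DiagramTables.IsFPVD

variable {D : DiagramTables} {S : Finset Plane}

/-- The table entry of an edge. -/
theorem exists_edge (hD : D.IsFPVD S) {a b : Plane} (hab : DefinesEdge S a b) :
    ∃ e, D.edgeSet S e = fpvdCell S a ∩ fpvdCell S b := by
  obtain ⟨e, he, -⟩ := hD.edge_complete a b hab
  refine ⟨e, ?_⟩
  rcases Sym2.eq_iff.1 he with ⟨h0, h1⟩ | ⟨h0, h1⟩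
  · rw [edgeSet, h0, h1]
  · rw [edgeSet, h0, h1, Set.inter_comm]

theorem adj (hD : D.IsFPVD S) {a b : Plane} (hab : DefinesEdge S a b) {i j : Fin D.numVertices}
    (hij : i ≠ j) (hi : D.vertex i ∈ fpvdCell S a ∩ fpvdCell S b)
    (hj : D.vertex j ∈ fpvdCell S a ∩ fpvdCell S b) : D.graph.Adj i j := by
  obtain ⟨e, he⟩ := hD.exists_edge hab
  exact ⟨hij, e, (hD.edgeEnd_spec e i).2 (he ▸ hi), (hD.edgeEnd_spec e j).2 (he ▸ hj)⟩

/-- An edge contains at most two vertices. -/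
theorem eq_of_mem_edge (hD : D.IsFPVD S) {a b : Plane} (hab : DefinesEdge S a b)
    {i j k : Fin D.numVertices} (hi : D.vertex i ∈ fpvdCell S a ∩ fpvdCell S b)
    (hj : D.vertex j ∈ fpvdCell S a ∩ fpvdCell S b)
    (hk : D.vertex k ∈ fpvdCell S a ∩ fpvdCell S b) : i = j ∨ i = k ∨ j = k := by
  obtain ⟨e, he⟩ := hD.exists_edge hab
  obtain ⟨x, hx⟩ := (hD.edgeEnd_spec e i).2 (he ▸ hi)
  obtain ⟨y, hy⟩ := (hD.edgeEnd_spec e j).2 (he ▸ hj)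
  obtain ⟨z, hz⟩ := (hD.edgeEnd_spec e k).2 (he ▸ hk)
  have h : x = y ∨ x = z ∨ y = z := by omega
  rcases h with rfl | rfl | rfl
  · exact .inl (Option.some.inj (hx.symm.trans hy))
  · exact .inr (.inl (Option.some.inj (hx.symm.trans hz)))
  · exact .inr (.inr (Option.some.inj (hy.symm.trans hz)))

theorem exists_of_adj (hD : D.IsFPVD S) {i j : Fin D.numVertices} (h : D.graph.Adj i j) :
    ∃ a b, DefinesEdge S a b ∧ D.vertex i ∈ fpvdCell S a ∩ fpvdCell S b ∧
      D.vertex j ∈ fpvdCell S a ∩ fpvdCell S b := by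
  obtain ⟨-, e, hi, hj⟩ := h
  exact ⟨_, _, hD.edgeSite_spec e, (hD.edgeEnd_spec e i).1 hi, (hD.edgeEnd_spec e j).1 hj⟩

theorem exists_index (hD : D.IsFPVD S) {p₁ p₂ p₃ v : Plane} (h : DefinesVertex S p₁ p₂ p₃ v) :
    ∃ j, D.vertex j = v := by
  have : v ∈ Set.range D.vertex := by rw [hD.vertex_range]; exact ⟨_, _, _, h⟩
  exact this

theorem site_mem (hD : D.IsFPVD S) (i : Fin D.numSites) : D.site i ∈ S := by
  have : D.site i ∈ (S : Set Plane) := by rw [← hD.site_range]; exact ⟨i, rfl⟩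
  exact this

theorem sqDist_vertexSite (hD : D.IsFPVD S) {j : Fin D.numVertices} {p : Plane} (hp : p ∈ S)
    (hj : D.vertex j ∈ fpvdCell S p) :
    sqDist (D.vertex j) (D.site (D.vertexSite j 0)) = sqDist (D.vertex j) p :=
  sqDist_eq_of_mem_fpvdCell (hD.site_mem _) hp (hD.vertexSite_spec j).mem.1 hj

/-- A vertex that is not terminal has a neighbour with a smaller enclosing disk. -/
theorem exists_adj_lt (hD : D.IsFPVD S) (hS : InGeneralPosition S) {j : Fin D.numVertices}
    (hj : ¬ Terminal S (D.vertex j)) : ∃ k, D.graph.Adj j k ∧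
      sqDist (D.vertex k) (D.site (D.vertexSite k 0)) <
        sqDist (D.vertex j) (D.site (D.vertexSite j 0)) := by
  unfold Terminal at hj
  push Not at hj
  obtain ⟨p₁, p₂, p₃, hv, ho, hn⟩ := hj
  obtain ⟨z, q, hz, hne, hlt⟩ := hv.exists_next hS ho hn
  obtain ⟨k, rfl⟩ := hD.exists_index hz
  refine ⟨k, ?_, ?_⟩
  · exact hD.adj ⟨hv.1, hv.2.1, hv.2.2.2.1, _, ⟨hz.mem.1, hz.mem.2.1⟩, _,
      ⟨hv.mem.1, hv.mem.2.1⟩, hne⟩ (fun h => hne (by rw [h]))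
      ⟨hv.mem.1, hv.mem.2.1⟩ ⟨hz.mem.1, hz.mem.2.1⟩
  · rwa [hD.sqDist_vertexSite hv.1 hv.mem.1, hD.sqDist_vertexSite hv.1 hz.mem.1]

/-- A vertex of smallest radius in the component of `j` is terminal, since the descent step would
otherwise lead to a smaller one. -/
theorem exists_reachable_terminal (hD : D.IsFPVD S) (hS : InGeneralPosition S)
    (j : Fin D.numVertices) : ∃ k, Terminal S (D.vertex k) ∧ D.graph.Reachable j k := by
  classical
  let f : Fin D.numVertices → ℝ := fun j => sqDist (D.vertex j) (D.site (D.vertexSite j 0))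
  obtain ⟨k, hk, hmin⟩ := (Finset.univ.filter fun k => D.graph.Reachable j k).exists_min_image f
    ⟨j, Finset.mem_filter.2 ⟨Finset.mem_univ _, SimpleGraph.Reachable.refl _⟩⟩
  rw [Finset.mem_filter] at hk
  refine ⟨k, by_contra fun h => ?_, hk.2⟩
  obtain ⟨l, hl, hlt⟩ := hD.exists_adj_lt hS h
  exact not_lt.2 (hmin l (Finset.mem_filter.2 ⟨Finset.mem_univ _, hk.2.trans hl.reachable⟩)) hlt

theorem reachable_of_mem_edge (hD : D.IsFPVD S) {a b : Plane} (hab : DefinesEdge S a b)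
    {i j : Fin D.numVertices} (hi : D.vertex i ∈ fpvdCell S a ∩ fpvdCell S b)
    (hj : D.vertex j ∈ fpvdCell S a ∩ fpvdCell S b) : D.graph.Reachable i j := by
  by_cases hij : i = j
  · rw [hij]
  · exact (hD.adj hab hij hi hj).reachable

/-- Both vertices are the unique optimal centre or share an edge with it. If two different edges
meet at the centre, it has a third farthest point and is itself a vertex joining them. -/
theorem reachable_of_terminal (hD : D.IsFPVD S) {i j : Fin D.numVertices}
    (hi : Terminal S (D.vertex i)) (hj : Terminal S (D.vertex j)) : D.graph.Reachable i j := by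
  obtain ⟨c, ρ, hc, hci⟩ := hi.exists_isOptimal (hD.vertexSite_spec i)
  obtain ⟨c', ρ', hc', hcj⟩ := hj.exists_isOptimal (hD.vertexSite_spec j)
  obtain rfl := hc.eq hc'
  rcases hci with rfl | ⟨a, b, hab, -, hia, hca⟩ <;>
  rcases hcj with h | ⟨a', b', hab', -, hja, hca'⟩
  · rw [hD.vertex_injective h]
  · exact hD.reachable_of_mem_edge hab' hca' hja
  · rw [h] at hca
    exact hD.reachable_of_mem_edge hab hia hca
  · by_cases hsame : (a' = a ∨ a' = b) ∧ (b' = a ∨ b' = b)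
    · have hne := hab'.2.2.1
      have : fpvdCell S a' ∩ fpvdCell S b' = fpvdCell S a ∩ fpvdCell S b := by
        rcases hsame with ⟨rfl | rfl, rfl | rfl⟩
        · exact absurd rfl hne
        · rfl
        · rw [Set.inter_comm]
        · exact absurd rfl hne
      rw [this] at hja
      exact hD.reachable_of_mem_edge hab hia hja
    · obtain ⟨q, hq, hcq, hqa, hqb⟩ : ∃ q ∈ S, c ∈ fpvdCell S q ∧ q ≠ a ∧ q ≠ b := by
        by_contra! hcon
        exact hsame ⟨by_contra fun h => (not_or.1 h).2 (hcon _ hab'.1 hca'.1 (not_or.1 h).1),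
          by_contra fun h => (not_or.1 h).2 (hcon _ hab'.2.1 hca'.2 (not_or.1 h).1)⟩
      obtain ⟨k, rfl⟩ := hD.exists_index
        (definesVertex_of_mem hab.1 hab.2.1 hq hab.2.2.1 hqa.symm hqb.symm hca.1 hca.2 hcq)
      exact (hD.reachable_of_mem_edge hab hia hca).trans (hD.reachable_of_mem_edge hab' hca' hja)

/-- The vertices and the bounded edges of the diagram form a connected graph. -/
theorem reachable (hD : D.IsFPVD S) (hS : InGeneralPosition S) (i j : Fin D.numVertices) :
    D.graph.Reachable i j := by
  obtain ⟨i', hi', hii'⟩ := hD.exists_reachable_terminal hS i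
  obtain ⟨j', hj', hjj'⟩ := hD.exists_reachable_terminal hS j
  exact (hii'.trans (hD.reachable_of_terminal hi' hj')).trans hjj'.symm

/-! ### Diagrams without vertices -/

/-- If there are no vertices, every edge is a whole line. -/
theorem mem_edge_of_isEmpty (hD : D.IsFPVD S) (hV : IsEmpty (Fin D.numVertices)) {a b : Plane}
    (ha : a ∈ S) (hb : b ∈ S) (hab : a ≠ b) {x : Plane} (hx : x ∈ fpvdCell S a ∩ fpvdCell S b) :
    ∀ y, sqDist y a = sqDist y b → y ∈ fpvdCell S a ∩ fpvdCell S b := by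
  intro y hy
  by_contra hn
  have hya : y ∉ fpvdCell S a := fun h => hn ⟨h, mem_fpvdCell_of_sqDist_eq h hy⟩
  obtain ⟨t, t0, t1, q, hq, hqlt, za, zq⟩ := exists_last_mem_fpvdCell hx.1 hya
  have zb : between x y t ∈ fpvdCell S b := by
    apply mem_fpvdCell_of_sqDist_eq za
    have := sqDist_between_sub x y a b t
    rw [hy, sqDist_eq_of_mem_fpvdCell ha hb hx.1 hx.2] at this
    linarith
  have hqa : a ≠ q := by rintro rfl; exact lt_irrefl _ hqlt
  have hqb : b ≠ q := by rintro rfl; exact absurd hqlt (by rw [hy]; exact lt_irrefl _)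
  obtain ⟨k, -⟩ := hD.exists_index (definesVertex_of_mem ha hb hq hab hqa hqb za zb zq)
  exact hV.false k

/-- The segment from `p` to its farthest site `a` leaves the cell of `a` and there meets another
cell. Without vertices the two cells share the whole bisector, which is an edge. -/
theorem exists_edge_of_isEmpty (hD : D.IsFPVD S) (hV : IsEmpty (Fin D.numVertices)) {p q : Plane}
    (hp : p ∈ S) (hq : q ∈ S) (hpq : p ≠ q) : 0 < D.numEdges := by
  obtain ⟨a, ha, hmax⟩ := S.exists_max_image (sqDist p) ⟨p, hp⟩
  have hpa : p ∈ fpvdCell S a := mem_fpvdCell.2 hmax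
  have haa : a ∉ fpvdCell S a := by
    intro h
    rw [mem_fpvdCell] at h
    have h0 : sqDist a a = 0 := by unfold sqDist; ring
    rw [h0] at h
    exact hpq ((eq_of_sqDist_nonpos (h p hp)).symm.trans (eq_of_sqDist_nonpos (h q hq)))
  obtain ⟨t, -, -, b, hb, hlt, za, zb⟩ := exists_last_mem_fpvdCell hpa haa
  have hab : a ≠ b := by rintro rfl; exact lt_irrefl _ hlt
  have hall := hD.mem_edge_of_isEmpty hV ha hb hab ⟨za, zb⟩
  have h1 := hall (mid a b) (by rw [sqDist_mid_left, sqDist_mid_right])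
  -- A second point of the bisector: the midpoint shifted by `a - b` turned through a right angle.
  let y : Plane := !₂[mid a b 0 + (a 1 - b 1), mid a b 1 - (a 0 - b 0)]
  have y0 : y 0 = mid a b 0 + (a 1 - b 1) := rfl
  have y1 : y 1 = mid a b 1 - (a 0 - b 0) := rfl
  have h2 := hall y (by unfold sqDist; rw [y0, y1]; simp [mid]; ring)
  have hne : mid a b ≠ y := by
    intro h
    apply hab
    rw [← h] at y0 y1
    exact plane_ext (by linarith) (by linarith)
  obtain ⟨e, -⟩ := hD.exists_edge ⟨ha, hb, hab, _, h1, _, h2, hne⟩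
  exact e.pos

end DiagramTables.IsFPVD

/-! ### Pieces of connected sets -/

open Relation in
/-- Any two vertices of `A` are joined by a path in `A`. -/
def ConnectedOn {V : Type*} (G : SimpleGraph V) (A : Set V) : Prop :=
  ∀ x ∈ A, ∀ y ∈ A, ReflTransGen (fun a b => a ∈ A ∧ b ∈ A ∧ G.Adj a b) x y

section Pieces

variable {V : Type*} {G : SimpleGraph V} {A B : Set V} {v : V}

open Relation

theorem reflTransGen_of_reachable_induce {x y : B} (h : (G.induce B).Reachable x y) :
    ReflTransGen (fun a b => a ∈ B ∧ b ∈ B ∧ G.Adj a b) (x : V) y := by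
  rw [SimpleGraph.reachable_iff_reflTransGen] at h
  induction h with
  | refl => exact .refl
  | @tail b c _ hbc ih => exact ih.tail ⟨b.2, c.2, hbc⟩

theorem reachable_induce_of_reflTransGen {x y : V} (hx : x ∈ B)
    (h : ReflTransGen (fun a b => a ∈ B ∧ b ∈ B ∧ G.Adj a b) x y) :
    ∃ hy : y ∈ B, (G.induce B).Reachable ⟨x, hx⟩ ⟨y, hy⟩ := by
  induction h with
  | refl => exact ⟨hx, .refl _⟩
  | tail _ hbc ih =>
    obtain ⟨hb, ih⟩ := ih
    exact ⟨hbc.2.1, ih.trans (SimpleGraph.Adj.reachable (G := G.induce B) hbc.2.2)⟩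

/-- Trades components of an induced graph on a subtype for path relations on `V` itself, the form
used from here on. -/
theorem mem_piecesAfterRemoval_iff {C : Set V} : C ∈ piecesAfterRemoval G A v ↔
    ∃ x ∈ A \ {v}, C = {y | ReflTransGen
      (fun a b => a ∈ A \ {v} ∧ b ∈ A \ {v} ∧ G.Adj a b) x y} := by
  have key : ∀ x : ↑(A \ {v}), Subtype.val '' ((G.induce (A \ {v})).connectedComponentMk x).supp =
      {y | ReflTransGen (fun a b => a ∈ A \ {v} ∧ b ∈ A \ {v} ∧ G.Adj a b) (x : V) y} := by
    intro x
    ext y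
    constructor
    · rintro ⟨y, hy, rfl⟩
      rw [SimpleGraph.ConnectedComponent.mem_supp_iff, SimpleGraph.ConnectedComponent.eq] at hy
      exact reflTransGen_of_reachable_induce hy.symm
    · intro hy
      obtain ⟨hy', hr⟩ := reachable_induce_of_reflTransGen x.2 hy
      refine ⟨⟨y, hy'⟩, ?_, rfl⟩
      rw [SimpleGraph.ConnectedComponent.mem_supp_iff, SimpleGraph.ConnectedComponent.eq]
      exact hr.symm
  constructor
  · rintro ⟨c, rfl⟩
    induction c using SimpleGraph.ConnectedComponent.ind with
    | h x => exact ⟨x, x.2, key x⟩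
  · rintro ⟨x, hx, rfl⟩
    exact ⟨(G.induce (A \ {v})).connectedComponentMk ⟨x, hx⟩, key ⟨x, hx⟩⟩

theorem exists_piece {x : V} (hx : x ∈ A \ {v}) : ∃ C ∈ piecesAfterRemoval G A v, x ∈ C :=
  ⟨_, mem_piecesAfterRemoval_iff.2 ⟨x, hx, rfl⟩, .refl⟩

theorem reflTransGen_symm {x y : V} (h : ReflTransGen (fun a b => a ∈ B ∧ b ∈ B ∧ G.Adj a b) x y) :
    ReflTransGen (fun a b => a ∈ B ∧ b ∈ B ∧ G.Adj a b) y x := by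
  induction h with
  | refl => exact .refl
  | tail _ hbc ih => exact ReflTransGen.head ⟨hbc.2.1, hbc.1, hbc.2.2.symm⟩ ih

theorem reflTransGen_of_mem_piece {C : Set V} (hC : C ∈ piecesAfterRemoval G A v) {x y : V}
    (hx : x ∈ C) (hy : y ∈ C) :
    ReflTransGen (fun a b => a ∈ A \ {v} ∧ b ∈ A \ {v} ∧ G.Adj a b) x y := by
  obtain ⟨z, hz, rfl⟩ := mem_piecesAfterRemoval_iff.1 hC
  exact (reflTransGen_symm hx).trans hy

theorem mem_piece_of_reflTransGen {C : Set V} (hC : C ∈ piecesAfterRemoval G A v) {x y : V}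
    (hx : x ∈ C) (h : ReflTransGen (fun a b => a ∈ A \ {v} ∧ b ∈ A \ {v} ∧ G.Adj a b) x y) :
    y ∈ C := by
  obtain ⟨z, hz, rfl⟩ := mem_piecesAfterRemoval_iff.1 hC
  exact ReflTransGen.trans hx h

theorem connectedOn_piece {C : Set V} (hC : C ∈ piecesAfterRemoval G A v) : ConnectedOn G C := by
  intro x hx y hy
  have h := reflTransGen_of_mem_piece hC hx hy
  clear hy
  induction h with
  | refl => exact .refl
  | tail hab hbc ih =>
    have hb := mem_piece_of_reflTransGen hC hx hab
    exact ih.tail ⟨hb, mem_piece_of_reflTransGen hC hb (.single hbc), hbc.2.2⟩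

/-- In a connected set every other vertex is joined to a neighbour of `v` by a path avoiding `v`. -/
theorem ConnectedOn.exists_adj (hA : ConnectedOn G A) (hv : v ∈ A) {x : V} (hx : x ∈ A \ {v}) :
    ∃ y ∈ A \ {v}, G.Adj y v ∧
      ReflTransGen (fun a b => a ∈ A \ {v} ∧ b ∈ A \ {v} ∧ G.Adj a b) x y := by
  have key : ∀ y, ReflTransGen (fun a b => a ∈ A ∧ b ∈ A ∧ G.Adj a b) x y →
      (y ∈ A \ {v} ∧ ReflTransGen (fun a b => a ∈ A \ {v} ∧ b ∈ A \ {v} ∧ G.Adj a b) x y) ∨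
      ∃ z ∈ A \ {v}, G.Adj z v ∧
        ReflTransGen (fun a b => a ∈ A \ {v} ∧ b ∈ A \ {v} ∧ G.Adj a b) x z := by
    intro y h
    induction h with
    | refl => exact .inl ⟨hx, .refl⟩
    | @tail b c _ hbc ih =>
      rcases ih with ⟨hb, ih⟩ | ih
      · by_cases hc : c = v
        · exact .inr ⟨b, hb, hc ▸ hbc.2.2, ih⟩
        · exact .inl ⟨⟨hbc.2.1, hc⟩, ih.tail ⟨hb, ⟨hbc.2.1, hc⟩, hbc.2.2⟩⟩
      · exact .inr ih
  rcases key v (hA x hx.1 v hv) with h | h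
  · exact absurd rfl h.1.2
  · exact h

end Pieces

/-! ### One step of the search -/

namespace DiagramTables.IsFPVD

variable {D : DiagramTables} {S : Finset Plane} {A : Set (Fin D.numVertices)}
  {v : Fin D.numVertices} {p₁ p₂ p₃ : Plane}

open Relation

theorem connectedOn_univ (hD : D.IsFPVD S) (hS : InGeneralPosition S) :
    ConnectedOn D.graph Set.univ := by
  intro x _ y _
  have h := hD.reachable hS x y
  rw [SimpleGraph.reachable_iff_reflTransGen] at h
  induction h with
  | refl => exact .refl
  | tail _ hbc ih => exact (ih trivial).tail ⟨trivial, trivial, hbc⟩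

/-- An edge has at most two end vertices, so the edges of a path avoiding `v` do not contain `v` and
none crosses the cone boundary. -/
theorem outside_of_reflTransGen (hD : D.IsFPVD S)
    (hv : DefinesVertex S p₁ p₂ p₃ (D.vertex v)) (ho : Obtuse (D.vertex v) p₁ p₂ p₃)
    {x y : Fin D.numVertices}
    (h : ReflTransGen (fun a b => a ∈ A \ {v} ∧ b ∈ A \ {v} ∧ D.graph.Adj a b) x y)
    (hx : Outside (D.vertex v) p₁ p₂ (D.vertex x)) :
    Outside (D.vertex v) p₁ p₂ (D.vertex y) := by
  induction h with
  | refl => exact hx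
  | @tail b c _ hbc ih =>
    obtain ⟨hb, hc, hadj⟩ := hbc
    obtain ⟨p, q, hpq, hbe, hce⟩ := hD.exists_of_adj hadj
    refine ih.of_mem_edge ho.cross_ne_zero hv.1 hv.2.1 hv.mem.1 hv.mem.2.1 hpq.1 hpq.2.1 hpq.2.2.1
      hbe hce fun hve => ?_
    rcases hD.eq_of_mem_edge hpq hbe hce hve with h | h | h
    · exact hadj.1 h
    · exact hb.2 h
    · exact hc.2 h

/-- Only one piece is outside of the cone. -/
theorem reflTransGen_of_outside (hD : D.IsFPVD S) (hS : InGeneralPosition S)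
    (hA : ConnectedOn D.graph A) (hvA : v ∈ A) (hv : DefinesVertex S p₁ p₂ p₃ (D.vertex v))
    (ho : Obtuse (D.vertex v) p₁ p₂ p₃) {x y : Fin D.numVertices} (hxA : x ∈ A \ {v})
    (hyA : y ∈ A \ {v}) (hx : Outside (D.vertex v) p₁ p₂ (D.vertex x))
    (hy : Outside (D.vertex v) p₁ p₂ (D.vertex y)) :
    ReflTransGen (fun a b => a ∈ A \ {v} ∧ b ∈ A \ {v} ∧ D.graph.Adj a b) x y := by
  obtain ⟨x', -, hx'v, hxx'⟩ := hA.exists_adj hvA hxA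
  obtain ⟨y', -, hy'v, hyy'⟩ := hA.exists_adj hvA hyA
  -- Each outside piece contains an outside neighbour of `v`. It lies on the edge defined by `p₁,
  -- p₂`, which has only one end besides `v`.
  have key : ∀ z, D.graph.Adj z v → Outside (D.vertex v) p₁ p₂ (D.vertex z) →
      DefinesEdge S p₁ p₂ ∧ D.vertex z ∈ fpvdCell S p₁ ∩ fpvdCell S p₂ := by
    intro z hz hout
    obtain ⟨a, b, hab, hza, hva⟩ := hD.exists_of_adj hz
    rcases hv.edge_eq_of_outside hS ho hab hva hza hout with ⟨rfl, rfl⟩ | ⟨rfl, rfl⟩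
    · exact ⟨hab, hza⟩
    · obtain ⟨h1, h2, h3, h4⟩ := hab
      rw [Set.inter_comm] at h4 hza
      exact ⟨⟨h2, h1, h3.symm, h4⟩, hza⟩
  obtain ⟨he, hx'e⟩ := key x' hx'v (hD.outside_of_reflTransGen hv ho hxx' hx)
  obtain ⟨-, hy'e⟩ := key y' hy'v (hD.outside_of_reflTransGen hv ho hyy' hy)
  have : x' = y' := by
    rcases hD.eq_of_mem_edge he hx'e hy'e ⟨hv.mem.1, hv.mem.2.1⟩ with h | h | h
    · exact h
    · exact absurd h hx'v.1
    · exact absurd h hy'v.1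
  subst this
  exact hxx'.trans (reflTransGen_symm hyy')

end DiagramTables.IsFPVD

/-- The search at vertex `v` replaces the best known lower bound `(c, ρ)` by `(c', ρ')` and moves on
to the vertex `next`, if any. -/
def SearchStep (D : DiagramTables) (S : Finset Plane)
    (child : Fin D.numVertices → Fin 3 → Option (Fin D.numVertices)) (v : Fin D.numVertices)
    (c : Plane) (ρ : ℝ) (c' : Plane) (ρ' : ℝ) (next : Option (Fin D.numVertices)) : Prop :=
  ∃ c₀ ρ₀, (ρ < ρ₀ ∧ c' = c₀ ∧ ρ' = ρ₀ ∨ ρ₀ ≤ ρ ∧ c' = c ∧ ρ' = ρ) ∧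
    ((IsOptimal S c₀ ρ₀ ∧ next = none) ∨
      ∃ p₁ p₂ p₃, DefinesVertex S p₁ p₂ p₃ (D.vertex v) ∧ Obtuse (D.vertex v) p₁ p₂ p₃ ∧
        c₀ = mid p₁ p₂ ∧ ρ₀ = sqDist p₁ p₂ / 4 ∧
        ((next = none ∧ ∀ i w, child v i = some w → ¬ Outside (D.vertex v) p₁ p₂ (D.vertex w)) ∨
          ∃ i w, child v i = some w ∧ Outside (D.vertex v) p₁ p₂ (D.vertex w) ∧ next = some w))

/-- The invariant of the search in the subtree with vertex set `A`. -/
def SearchInvariant (D : DiagramTables) (S : Finset Plane) (A : Set (Fin D.numVertices))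
    (c : Plane) (ρ : ℝ) : Prop :=
  LowerBound S c ρ ∧
    (IsOptimal S c ρ ∨ ConnectedOn D.graph A ∧ ∃ j ∈ A, Terminal S (D.vertex j))

/-- Unless the best bound has become optimal, the terminal vertex of `A` differs from `v` and is
outside the cone. Its piece is then the only outside one, so the search enters it and cannot stop.
-/
theorem SearchStep.invariant {D : DiagramTables} {S : Finset Plane} (hD : D.IsFPVD S)
    (hS : InGeneralPosition S)
    {child : Fin D.numVertices → Fin 3 → Option (Fin D.numVertices)} {v : Fin D.numVertices}
    {c c' : Plane} {ρ ρ' : ℝ} {next : Option (Fin D.numVertices)}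
    (h : SearchStep D S child v c ρ c' ρ' next) {A : Set (Fin D.numVertices)}
    (hA : IsCentroidTree D.graph child A v) (hinv : SearchInvariant D S A c ρ) :
    (next = none → IsOptimal S c' ρ') ∧ ∀ w, next = some w →
      ∃ C : Set (Fin D.numVertices), 2 * C.ncard ≤ A.ncard ∧ IsCentroidTree D.graph child C w ∧
        SearchInvariant D S C c' ρ' := by
  obtain ⟨A, v, hvA, half, child_mem, one_child, sub⟩ := hA
  obtain ⟨c₀, ρ₀, hupd, hcase⟩ := h
  obtain ⟨hlb, hinv⟩ := hinv
  have hlb₀ : LowerBound S c₀ ρ₀ := by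
    rcases hcase with ⟨h, -⟩ | ⟨p₁, p₂, p₃, hv, -, rfl, rfl, -⟩
    · exact h.2
    · exact lowerBound_mid hv.1 hv.2.1
  have hlb' : LowerBound S c' ρ' := by
    rcases hupd with ⟨-, rfl, rfl⟩ | ⟨-, rfl, rfl⟩ <;> assumption
  -- No lower bound exceeds the optimum, so keeping the larger of two never loses an optimal one.
  have hopt' : (IsOptimal S c ρ ∨ IsOptimal S c₀ ρ₀) → IsOptimal S c' ρ' := by
    rintro (hopt | hopt) <;> rcases hupd with ⟨hlt, rfl, rfl⟩ | ⟨hle, rfl, rfl⟩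
    · obtain ⟨rfl, rfl⟩ := hlb₀.eq_of_isOptimal hopt hlt.le
      exact hopt
    · exact hopt
    · exact hopt
    · obtain ⟨rfl, rfl⟩ := hlb.eq_of_isOptimal hopt hle
      exact hopt
  rcases hcase with ⟨hopt, hnext⟩ | ⟨p₁, p₂, p₃, hv, ho, rfl, rfl, hnext⟩
  · refine ⟨fun _ => hopt' (.inr hopt), fun w hw => ?_⟩
    rw [hnext] at hw; cases hw
  -- Once the answer is known, the direction is irrelevant: any child keeps the invariant.
  by_cases hdone : IsOptimal S c' ρ'
  · refine ⟨fun _ => hdone, fun w hw => ?_⟩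
    rcases hnext with ⟨hnone, -⟩ | ⟨i, w', hw', -, hsome⟩
    · rw [hnone] at hw; cases hw
    obtain rfl : w' = w := Option.some.inj (hsome.symm.trans hw)
    obtain ⟨C, hC, hwC⟩ := exists_piece (G := D.graph) (child_mem i w' hw')
    exact ⟨C, half C hC, sub C hC i w' hwC hw', hlb', .inl hdone⟩
  obtain ⟨hconn, j, hjA, hjt⟩ := hinv.resolve_left fun h => hdone (hopt' (.inl h))
  have hn : ¬ IsOptimal S (mid p₁ p₂) (sqDist p₁ p₂ / 4) := fun h => hdone (hopt' (.inr h))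
  have hjv : j ∈ A \ {v} := ⟨hjA, by rintro rfl; exact hn (hjt _ _ _ hv ho)⟩
  have hjout := hjt.outside hS hv ho hn (hD.vertexSite_spec j)
  obtain ⟨C, hC, hjC⟩ := exists_piece (G := D.graph) hjv
  rcases hnext with ⟨hnone, hno⟩ | ⟨i, w', hw', hout, hsome⟩
  · obtain ⟨i, ⟨w, hwC, hw⟩, -⟩ := one_child C hC
    exact (hno i w hw (hD.outside_of_reflTransGen hv ho
      (reflTransGen_of_mem_piece hC hjC hwC) hjout)).elim
  · refine ⟨fun h => (Option.some_ne_none _ (hsome.symm.trans h)).elim, fun w hw => ?_⟩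
    obtain rfl : w' = w := Option.some.inj (hsome.symm.trans hw)
    have hwC : w' ∈ C := mem_piece_of_reflTransGen hC hjC
      (hD.reflTransGen_of_outside hS hconn hvA hv ho hjv (child_mem i w' hw') hjout hout)
    exact ⟨C, half C hC, sub C hC i w' hwC hw', hlb', .inr ⟨connectedOn_piece hC, j, hjC, hjt⟩⟩

namespace RealRAM

/-! ### Programs without loops -/

/-- The real register that an operation changes. -/
def Op.realTarget : Op → Option ℕ
  | rconst r _ | rcopy r _ | radd r _ _ | rsub r _ _ | rmul r _ _ | rdiv r _ _ | rload r _ _ =>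
    some r
  | _ => none

/-- The index register that an operation changes. -/
def Op.natTarget : Op → Option ℕ
  | nconst r _ | ncopy r _ | nadd r _ _ | nsub r _ _ | nload r _ _ => some r
  | _ => none

/-- The operation does not change any array. -/
def Op.keepsArrays : Op → Bool
  | nstore _ _ _ | rstore _ _ _ => false
  | _ => true

namespace Program

/-- The program has no loops and all of its operations satisfy `f`. -/
def all (f : Op → Bool) : Program → Bool
  | skip => true
  | op o => f o
  | seq P Q => P.all f && Q.all f
  | ite _ P Q => P.all f && Q.all f
  | loop _ _ => false

/-- The number of operations and tests in a program. -/
def size : Program → ℕ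
  | skip => 0
  | op _ => 1
  | seq P Q => P.size + Q.size
  | ite _ P Q => P.size + Q.size + 1
  | loop _ P => P.size + 1

open Classical in
/-- The final state of a program without loops. -/
noncomputable def run : Program → State → State
  | skip, σ => σ
  | op o, σ => o.apply σ
  | seq P Q, σ => Q.run (P.run σ)
  | ite b P Q, σ => if b.Holds σ then P.run σ else Q.run σ
  | loop _ _, σ => σ

/-- A sequence of operations. -/
def ops : List Op → Program
  | [] => skip
  | o :: l => seq (op o) (ops l)

theorem run_seq (P Q : Program) (σ : State) : (seq P Q).run σ = Q.run (P.run σ) := rfl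

theorem run_ite_pos {b : Test} {P Q : Program} {σ : State} (h : b.Holds σ) :
    (ite b P Q).run σ = P.run σ := if_pos h

theorem run_ite_neg {b : Test} {P Q : Program} {σ : State} (h : ¬ b.Holds σ) :
    (ite b P Q).run σ = Q.run σ := if_neg h

theorem exec_run {f : Op → Bool} {P : Program} (hP : P.all f = true) (σ : State) :
    ∃ t ≤ P.size, Exec P σ (P.run σ) t := by
  induction P generalizing σ with
  | skip => exact ⟨0, le_rfl, .skip σ⟩
  | op o => exact ⟨1, le_rfl, .op o σ⟩
  | seq P Q ihP ihQ =>
    rw [all, Bool.and_eq_true] at hP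
    obtain ⟨s, hs, hPs⟩ := ihP hP.1 σ
    obtain ⟨t, ht, hQt⟩ := ihQ hP.2 (P.run σ)
    exact ⟨s + t, add_le_add hs ht, .seq hPs hQt⟩
  | ite b P Q ihP ihQ =>
    rw [all, Bool.and_eq_true] at hP
    by_cases hb : b.Holds σ
    · obtain ⟨s, hs, hPs⟩ := ihP hP.1 σ
      refine ⟨s + 1, by rw [size]; omega, ?_⟩
      rw [run_ite_pos hb]
      exact .ite_true hb hPs
    · obtain ⟨s, hs, hQs⟩ := ihQ hP.2 σ
      refine ⟨s + 1, by rw [size]; omega, ?_⟩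
      rw [run_ite_neg hb]
      exact .ite_false hb hQs
  | loop b P => simp [all] at hP

/-- What every operation of a program without loops preserves is preserved by the program. -/
theorem run_preserves {α : Type*} (g : State → α) {f : Op → Bool}
    (hf : ∀ o σ, f o = true → g (o.apply σ) = g σ) {P : Program} (hP : P.all f = true)
    (σ : State) : g (P.run σ) = g σ := by
  induction P generalizing σ with
  | skip => rfl
  | op o => exact hf o σ hP
  | seq P Q ihP ihQ =>
    rw [all, Bool.and_eq_true] at hP
    exact (ihQ hP.2 _).trans (ihP hP.1 σ)
  | ite b P Q ihP ihQ =>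
    rw [all, Bool.and_eq_true] at hP
    by_cases hb : b.Holds σ
    · rw [run_ite_pos hb, ihP hP.1]
    · rw [run_ite_neg hb, ihQ hP.2]
  | loop b P => rfl

/-- A frame rule whose side condition is a Boolean computed from the program text, so that `rfl`
discharges it for concrete programs. -/
theorem run_real (r : ℕ) {P : Program} (hP : P.all (fun o => o.realTarget != some r) = true)
    (σ : State) : (P.run σ).real r = σ.real r := by
  refine run_preserves (fun σ => σ.real r) (fun o σ h => ?_) hP σ
  cases o <;> simp only [Op.realTarget, Op.apply, bne_iff_ne, ne_eq, Option.some.injEq] at h ⊢ <;>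
    exact Function.update_of_ne (Ne.symm h) _ _

theorem run_nat (r : ℕ) {P : Program} (hP : P.all (fun o => o.natTarget != some r) = true)
    (σ : State) : (P.run σ).nat r = σ.nat r := by
  refine run_preserves (fun σ => σ.nat r) (fun o σ h => ?_) hP σ
  cases o <;> simp only [Op.natTarget, Op.apply, bne_iff_ne, ne_eq, Option.some.injEq] at h ⊢ <;>
    exact Function.update_of_ne (Ne.symm h) _ _

theorem run_arrays {P : Program} (hP : P.all Op.keepsArrays = true) (σ : State) :
    ((P.run σ).natArr, (P.run σ).realArr) = (σ.natArr, σ.realArr) := by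
  refine run_preserves (fun σ => (σ.natArr, σ.realArr)) (fun o σ h => ?_) hP σ
  cases o <;> first | rfl | cases h

end Program

/-! ### The program -/

open Program Op Test

/-- Load the vertex with pointer in register `3` and the vectors to its defining points, and compute
the products that tell whether their triangle is obtuse. -/
def loadVertex : Program := ops
  [nsub 6 3 5, rload 3 2 6, rload 4 3 6,
    nload 7 0 6, rload 5 0 7, rload 6 1 7,
    nload 7 1 6, rload 7 0 7, rload 8 1 7,
    nload 7 2 6, rload 9 0 7, rload 10 1 7,
    rsub 5 5 3, rsub 6 6 4, rsub 7 7 3, rsub 8 8 4, rsub 9 9 3, rsub 10 10 4,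
    rmul 16 5 8, rmul 17 6 7, rsub 11 16 17,
    rmul 16 7 10, rmul 17 8 9, rsub 12 16 17,
    rmul 16 9 6, rmul 17 10 5, rsub 13 16 17,
    radd 14 11 12, radd 14 14 13, rmul 11 11 14, rmul 12 12 14, rmul 13 13 14,
    rconst 18 0, nconst 8 0]

/-- The candidate at a vertex in its triangle. -/
def acuteCandidate : Program := ops
  [rcopy 24 3, rcopy 25 4, rmul 16 5 5, rmul 17 6 6, radd 26 16 17]

/-- Copy the vectors to the ends of the longest side. -/
def copySide (x₁ y₁ x₂ y₂ : ℕ) : Program := ops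
  [rcopy 20 x₁, rcopy 21 y₁, rcopy 22 x₂, rcopy 23 y₂]

/-- The candidate at a vertex with an obtuse triangle. -/
def obtuseCandidate : Program := ops
  [rconst 34 2, rconst 35 4,
    radd 24 20 22, rdiv 24 24 34, radd 24 3 24,
    radd 25 21 23, rdiv 25 25 34, radd 25 4 25,
    rsub 16 20 22, rmul 16 16 16, rsub 17 21 23, rmul 17 17 17, radd 26 16 17, rdiv 26 26 35,
    rmul 16 20 23, rmul 17 21 22, rsub 27 16 17]

/-- Load the vertex with pointer in register `9` and compute the products that tell whether it is
outside of the cone. -/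
def loadChild : Program := ops
  [nsub 10 9 5, rload 28 2 10, rload 29 3 10, rsub 28 28 3, rsub 29 29 4,
    rmul 32 28 23, rmul 33 29 22, rsub 30 32 33, rmul 30 27 30,
    rmul 32 20 29, rmul 33 21 28, rsub 31 32 33, rmul 31 27 31]

/-- Choose child number `k` if it is outside of the cone. -/
def testChild (k : ℕ) : Program :=
  seq (op (nload 9 (3 + k) 6)) (ite (natEq 9 4) skip (seq loadChild
    (ite (realLt 18 30) (op (ncopy 8 9)) (ite (realLt 18 31) (op (ncopy 8 9)) skip))))

/-- Process a vertex with an obtuse triangle. -/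
def obtuseVertex (x₁ y₁ x₂ y₂ : ℕ) : Program :=
  seq (copySide x₁ y₁ x₂ y₂)
    (seq obtuseCandidate (seq (testChild 0) (seq (testChild 1) (testChild 2))))

/-- Compute the candidate and the next vertex. -/
def processVertex : Program :=
  ite (realLt 11 18) (obtuseVertex 5 6 7 8)
    (ite (realLt 12 18) (obtuseVertex 7 8 9 10)
      (ite (realLt 13 18) (obtuseVertex 9 10 5 6) acuteCandidate))

/-- Keep the better one of two lower bounds. -/
def updateBest : Program := ite (realLt 2 26) (ops [rcopy 0 24, rcopy 1 25, rcopy 2 26]) skip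

/-- One step of the search. -/
def searchBody : Program :=
  seq loadVertex (seq processVertex (seq updateBest (op (ncopy 3 8))))

/-- The lower bound given by edge number `0`. -/
def edgeBound : Program := ops
  [nload 6 9 4, nload 7 10 4, rload 3 0 6, rload 4 1 6, rload 5 0 7, rload 6 1 7,
    rconst 34 2, rconst 35 4,
    radd 0 3 5, rdiv 0 0 34, radd 1 4 6, rdiv 1 1 34,
    rsub 16 3 5, rmul 16 16 16, rsub 17 4 6, rmul 17 17 17, radd 2 16 17, rdiv 2 2 35]

/-- The first lower bound. -/
def firstBound : Program :=
  seq (ops [nconst 4 0, nconst 5 1, rload 0 0 4, rload 1 1 4, rconst 2 0])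
    (ite (natLt 4 2) edgeBound skip)

/-- Search for the smallest enclosing disk in the centroid decomposition. -/
def diskSearch : Program := seq firstBound (loop (natLt 4 3) searchBody)

/-! ### Correctness of the search step -/

/-- The part of the memory that the search uses. -/
structure SearchMemory (σ : State) (D : DiagramTables)
    (child : Fin D.numVertices → Fin 3 → Option (Fin D.numVertices)) : Prop where
  zero : σ.nat 4 = 0
  one : σ.nat 5 = 1
  site : ∀ (i : Fin D.numSites) (k : Fin 2), σ.realArr k i = D.site i k
  vertex : ∀ (j : Fin D.numVertices) (k : Fin 2), σ.realArr (2 + k) j = D.vertex j k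
  vertexSite : ∀ (j : Fin D.numVertices) (k : Fin 3), σ.natArr k j = D.vertexSite j k
  child : ∀ (j : Fin D.numVertices) (k : Fin 3), σ.natArr (3 + k) j = encodePointer (child j k)

section Search

variable {D : DiagramTables} {child : Fin D.numVertices → Fin 3 → Option (Fin D.numVertices)}
  {σ : State} {v : Fin D.numVertices}

theorem SearchMemory.run (hσ : SearchMemory σ D child) {P : Program}
    (ha : P.all Op.keepsArrays = true) (h4 : P.all (fun o => o.natTarget != some 4) = true)
    (h5 : P.all (fun o => o.natTarget != some 5) = true) : SearchMemory (P.run σ) D child := by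
  have h := run_arrays ha σ
  rw [Prod.mk.injEq] at h
  exact ⟨(run_nat 4 h4 σ).trans hσ.zero, (run_nat 5 h5 σ).trans hσ.one, h.2 ▸ hσ.site,
    h.2 ▸ hσ.vertex, h.1 ▸ hσ.vertexSite, h.1 ▸ hσ.child⟩

/-- Registers `6`, `3` and `4` contain the index and the coordinates of the vertex `v`. -/
structure AtVertex (σ : State) (D : DiagramTables) (v : Fin D.numVertices) : Prop where
  index : σ.nat 6 = v
  x : σ.real 3 = D.vertex v 0
  y : σ.real 4 = D.vertex v 1
  zero : σ.real 18 = 0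

theorem AtVertex.run (hσ : AtVertex σ D v) {P : Program}
    (h6 : P.all (fun o => o.natTarget != some 6) = true)
    (h3 : P.all (fun o => o.realTarget != some 3) = true)
    (h4 : P.all (fun o => o.realTarget != some 4) = true)
    (h18 : P.all (fun o => o.realTarget != some 18) = true) : AtVertex (P.run σ) D v :=
  ⟨(run_nat 6 h6 σ).trans hσ.index, (run_real 3 h3 σ).trans hσ.x, (run_real 4 h4 σ).trans hσ.y,
    (run_real 18 h18 σ).trans hσ.zero⟩

/-- The registers `r`, `s` contain the vector from `o` to `p`. -/
def HoldsVector (σ : State) (r s : ℕ) (o p : Plane) : Prop :=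
  σ.real r = p 0 - o 0 ∧ σ.real s = p 1 - o 1

theorem HoldsVector.run {r s : ℕ} {o p : Plane} (hσ : HoldsVector σ r s o p) {P : Program}
    (hr : P.all (fun o => o.realTarget != some r) = true)
    (hs : P.all (fun o => o.realTarget != some s) = true) : HoldsVector (P.run σ) r s o p :=
  ⟨(run_real r hr σ).trans hσ.1, (run_real s hs σ).trans hσ.2⟩

theorem loadVertex_spec (hσ : SearchMemory σ D child) (hv : σ.nat 3 = v + 1) :
    AtVertex (loadVertex.run σ) D v ∧ (loadVertex.run σ).nat 8 = 0 ∧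
      HoldsVector (loadVertex.run σ) 5 6 (D.vertex v) (D.site (D.vertexSite v 0)) ∧
      HoldsVector (loadVertex.run σ) 7 8 (D.vertex v) (D.site (D.vertexSite v 1)) ∧
      HoldsVector (loadVertex.run σ) 9 10 (D.vertex v) (D.site (D.vertexSite v 2)) := by
  have h6 : (loadVertex.run σ).nat 6 = v := by
    have : (loadVertex.run σ).nat 6 = σ.nat 3 - σ.nat 5 := rfl
    rw [this, hv, hσ.one, Nat.add_sub_cancel]
  have h3 : (loadVertex.run σ).real 3 = D.vertex v 0 := by
    have : (loadVertex.run σ).real 3 = σ.realArr 2 ((loadVertex.run σ).nat 6) := rfl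
    rw [this, h6]; exact hσ.vertex v 0
  have h4 : (loadVertex.run σ).real 4 = D.vertex v 1 := by
    have : (loadVertex.run σ).real 4 = σ.realArr 3 ((loadVertex.run σ).nat 6) := rfl
    rw [this, h6]; exact hσ.vertex v 1
  have hx : ∀ k : Fin 3, σ.realArr 0 (σ.natArr k v) = D.site (D.vertexSite v k) 0 := fun k => by
    rw [hσ.vertexSite]; exact hσ.site _ 0
  have hy : ∀ k : Fin 3, σ.realArr 1 (σ.natArr k v) = D.site (D.vertexSite v k) 1 := fun k => by
    rw [hσ.vertexSite]; exact hσ.site _ 1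
  refine ⟨⟨h6, h3, h4, ?_⟩, rfl, ⟨?_, ?_⟩, ⟨?_, ?_⟩, ?_, ?_⟩
  · exact Int.cast_zero
  · rw [← hx, ← h3, ← h6]; rfl
  · rw [← hy, ← h4, ← h6]; rfl
  · rw [← hx, ← h3, ← h6]; rfl
  · rw [← hy, ← h4, ← h6]; rfl
  · rw [← hx, ← h3, ← h6]; rfl
  · rw [← hy, ← h4, ← h6]; rfl

/-- The program obtains the cross product of the triangle as the sum of the three cross products at
`o`; it is invariant under rotation, so one value serves all three tests. -/
theorem loadVertex_products (σ : State) {o p₁ p₂ p₃ : Plane}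
    (h1 : HoldsVector (loadVertex.run σ) 5 6 o p₁) (h2 : HoldsVector (loadVertex.run σ) 7 8 o p₂)
    (h3 : HoldsVector (loadVertex.run σ) 9 10 o p₃) :
    (loadVertex.run σ).real 11 = cross o p₁ p₂ * cross p₁ p₂ p₃ ∧
      (loadVertex.run σ).real 12 = cross o p₂ p₃ * cross p₂ p₃ p₁ ∧
      (loadVertex.run σ).real 13 = cross o p₃ p₁ * cross p₃ p₁ p₂ := by
  have k12 : (loadVertex.run σ).real 5 * (loadVertex.run σ).real 8 -
      (loadVertex.run σ).real 6 * (loadVertex.run σ).real 7 = cross o p₁ p₂ := by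
    rw [h1.1, h1.2, h2.1, h2.2, cross]
  have k23 : (loadVertex.run σ).real 7 * (loadVertex.run σ).real 10 -
      (loadVertex.run σ).real 8 * (loadVertex.run σ).real 9 = cross o p₂ p₃ := by
    rw [h2.1, h2.2, h3.1, h3.2, cross]
  have k31 : (loadVertex.run σ).real 9 * (loadVertex.run σ).real 6 -
      (loadVertex.run σ).real 10 * (loadVertex.run σ).real 5 = cross o p₃ p₁ := by
    rw [h3.1, h3.2, h1.1, h1.2, cross]
  have e2 : cross p₂ p₃ p₁ = cross p₁ p₂ p₃ := by unfold cross; ring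
  have e3 : cross p₃ p₁ p₂ = cross p₁ p₂ p₃ := by unfold cross; ring
  rw [e2, e3, ← cross_sum_eq o p₁ p₂ p₃, ← k12, ← k23, ← k31]
  exact ⟨rfl, rfl, rfl⟩

/-- The registers describe the vertex `v` and the cone opposite to `p₁` and `p₂`. -/
structure AtCone (σ : State) (D : DiagramTables)
    (child : Fin D.numVertices → Fin 3 → Option (Fin D.numVertices)) (v : Fin D.numVertices)
    (p₁ p₂ : Plane) : Prop where
  memory : SearchMemory σ D child
  atVertex : AtVertex σ D v
  left : HoldsVector σ 20 21 (D.vertex v) p₁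
  right : HoldsVector σ 22 23 (D.vertex v) p₂
  cross : σ.real 27 = cross (D.vertex v) p₁ p₂

variable {p₁ p₂ : Plane}

theorem AtCone.testChild (hσ : AtCone σ D child v p₁ p₂) (k : ℕ) :
    AtCone ((testChild k).run σ) D child v p₁ p₂ :=
  ⟨hσ.memory.run rfl rfl rfl, hσ.atVertex.run rfl rfl rfl rfl, hσ.left.run rfl rfl,
    hσ.right.run rfl rfl, (run_real 27 rfl σ).trans hσ.cross⟩

theorem loadChild_products (hσ : AtCone σ D child v p₁ p₂) {w : Fin D.numVertices}
    (hw : σ.nat 9 = w + 1) :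
    (loadChild.run σ).real 30 =
        cross (D.vertex v) p₁ p₂ * cross (D.vertex v) (D.vertex w) p₂ ∧
      (loadChild.run σ).real 31 =
        cross (D.vertex v) p₁ p₂ * cross (D.vertex v) p₁ (D.vertex w) := by
  have h10 : σ.nat 9 - σ.nat 5 = w := by rw [hw, hσ.memory.one, Nat.add_sub_cancel]
  have hx : σ.realArr 2 (σ.nat 9 - σ.nat 5) = D.vertex w 0 := by
    rw [h10]; exact hσ.memory.vertex w 0
  have hy : σ.realArr 3 (σ.nat 9 - σ.nat 5) = D.vertex w 1 := by
    rw [h10]; exact hσ.memory.vertex w 1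
  rw [← hσ.cross, _root_.cross, _root_.cross, ← hσ.left.1, ← hσ.left.2, ← hσ.right.1, ← hσ.right.2,
    ← hσ.atVertex.x, ← hσ.atVertex.y, ← hx, ← hy]
  exact ⟨rfl, rfl⟩

theorem testChild_spec (hσ : AtCone σ D child v p₁ p₂) (k : Fin 3) :
    (∃ w, child v k = some w ∧ Outside (D.vertex v) p₁ p₂ (D.vertex w) ∧
      ((testChild k).run σ).nat 8 = w + 1) ∨
    ((∀ w, child v k = some w → ¬ Outside (D.vertex v) p₁ p₂ (D.vertex w)) ∧
      ((testChild k).run σ).nat 8 = σ.nat 8) := by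
  obtain ⟨σ₁, hσ₁⟩ : ∃ σ₁, σ₁ = (op (nload 9 (3 + k) 6)).run σ := ⟨_, rfl⟩
  have hc : AtCone σ₁ D child v p₁ p₂ := by
    subst hσ₁
    exact ⟨hσ.memory.run rfl rfl rfl, hσ.atVertex.run rfl rfl rfl rfl, hσ.left.run rfl rfl,
      hσ.right.run rfl rfl, (run_real 27 rfl σ).trans hσ.cross⟩
  have h9 : σ₁.nat 9 = encodePointer (child v k) := by
    have : σ₁.nat 9 = σ.natArr (3 + k) (σ.nat 6) := by subst hσ₁; rfl
    rw [this, hσ.atVertex.index, hσ.memory.child]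
  have h8 : σ₁.nat 8 = σ.nat 8 := by subst hσ₁; rfl
  rw [testChild, run_seq, ← hσ₁]
  cases hk : child v k with
  | none =>
    right
    rw [hk] at h9
    rw [run_ite_pos (show (natEq 9 4).Holds σ₁ from h9.trans hc.memory.zero.symm)]
    exact ⟨fun w hw => (Option.some_ne_none w hw.symm).elim, h8⟩
  | some w =>
    rw [hk] at h9
    have h9' : σ₁.nat 9 = w + 1 := h9
    have hne : ¬ (natEq 9 4).Holds σ₁ := fun h : σ₁.nat 9 = σ₁.nat 4 => by
      rw [h9', hc.memory.zero] at h; omega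
    rw [run_ite_neg hne, run_seq]
    obtain ⟨h30, h31⟩ := loadChild_products hc h9'
    have h18 : (loadChild.run σ₁).real 18 = 0 := (run_real 18 rfl σ₁).trans hc.atVertex.zero
    have h9'' : (loadChild.run σ₁).nat 9 = w + 1 := (run_nat 9 rfl σ₁).trans h9'
    have h8' : (loadChild.run σ₁).nat 8 = σ.nat 8 := (run_nat 8 rfl σ₁).trans h8
    have t30 : (realLt 18 30).Holds (loadChild.run σ₁) ↔
        0 < _root_.cross (D.vertex v) p₁ p₂ * _root_.cross (D.vertex v) (D.vertex w) p₂ := by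
      rw [← h30, ← h18]; rfl
    have t31 : (realLt 18 31).Holds (loadChild.run σ₁) ↔
        0 < _root_.cross (D.vertex v) p₁ p₂ * _root_.cross (D.vertex v) p₁ (D.vertex w) := by
      rw [← h31, ← h18]; rfl
    by_cases b30 : (realLt 18 30).Holds (loadChild.run σ₁)
    · rw [run_ite_pos b30]
      exact .inl ⟨w, rfl, .inl (t30.1 b30), h9''⟩
    rw [run_ite_neg b30]
    by_cases b31 : (realLt 18 31).Holds (loadChild.run σ₁)
    · rw [run_ite_pos b31]
      exact .inl ⟨w, rfl, .inr (t31.1 b31), h9''⟩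
    · rw [run_ite_neg b31]
      refine .inr ⟨fun w' hw' hout => ?_, h8'⟩
      obtain rfl := Option.some.inj hw'
      exact hout.elim (fun h => b30 (t30.2 h)) fun h => b31 (t31.2 h)

/-- The three tests find a child outside of the cone if there is one. -/
theorem testChildren_spec (hσ : AtCone σ D child v p₁ p₂) (h8 : σ.nat 8 = 0) :
    ∃ next, ((seq (testChild 0) (seq (testChild 1) (testChild 2))).run σ).nat 8 =
        encodePointer next ∧
      ((next = none ∧ ∀ i w, child v i = some w → ¬ Outside (D.vertex v) p₁ p₂ (D.vertex w)) ∨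
        ∃ i w, child v i = some w ∧ Outside (D.vertex v) p₁ p₂ (D.vertex w) ∧ next = some w) := by
  rw [run_seq, run_seq]
  have c1 := hσ.testChild 0
  have c2 := c1.testChild 1
  -- A later test overwrites register `8`, so the last successful child decides and the cases run
  -- backwards.
  rcases testChild_spec c2 2 with ⟨w, hw, hout, h⟩ | ⟨h2, e2⟩
  · exact ⟨some w, h, .inr ⟨2, w, hw, hout, rfl⟩⟩
  rcases testChild_spec c1 1 with ⟨w, hw, hout, h⟩ | ⟨h1, e1⟩
  · exact ⟨some w, e2.trans h, .inr ⟨1, w, hw, hout, rfl⟩⟩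
  rcases testChild_spec hσ 0 with ⟨w, hw, hout, h⟩ | ⟨h0, e0⟩
  · exact ⟨some w, e2.trans (e1.trans h), .inr ⟨0, w, hw, hout, rfl⟩⟩
  refine ⟨none, e2.trans (e1.trans (e0.trans h8)), .inl ⟨rfl, fun i => ?_⟩⟩
  fin_cases i
  · exact h0
  · exact h1
  · exact h2

/-- The registers `24, 25` contain the candidate centre and `26` the squared radius. -/
def HoldsCandidate (σ : State) (c : Plane) (ρ : ℝ) : Prop :=
  σ.real 24 = c 0 ∧ σ.real 25 = c 1 ∧ σ.real 26 = ρ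

/-- The bounds by `20` ensure that the copies into registers `20` to `23` do not overwrite a source
still to be read; `x₁` is read first and needs none. -/
theorem obtuseVertex_spec (hm : SearchMemory σ D child) (hv : AtVertex σ D v) (h8 : σ.nat 8 = 0)
    {x₁ y₁ x₂ y₂ : ℕ} (hy₁ : y₁ < 20) (hx₂ : x₂ < 20) (hy₂ : y₂ < 20)
    (h1 : HoldsVector σ x₁ y₁ (D.vertex v) p₁) (h2 : HoldsVector σ x₂ y₂ (D.vertex v) p₂) :
    HoldsCandidate ((obtuseVertex x₁ y₁ x₂ y₂).run σ) (mid p₁ p₂) (sqDist p₁ p₂ / 4) ∧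
    ∃ next, ((obtuseVertex x₁ y₁ x₂ y₂).run σ).nat 8 = encodePointer next ∧
      ((next = none ∧ ∀ i w, child v i = some w → ¬ Outside (D.vertex v) p₁ p₂ (D.vertex w)) ∨
        ∃ i w, child v i = some w ∧ Outside (D.vertex v) p₁ p₂ (D.vertex w) ∧ next = some w) := by
  obtain ⟨σ₁, hσ₁⟩ : ∃ σ₁, σ₁ = (copySide x₁ y₁ x₂ y₂).run σ := ⟨_, rfl⟩
  have hm₁ : SearchMemory σ₁ D child := hσ₁ ▸ hm.run rfl rfl rfl
  have hv₁ : AtVertex σ₁ D v := hσ₁ ▸ hv.run rfl rfl rfl rfl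
  have h8₁ : σ₁.nat 8 = 0 := hσ₁ ▸ (run_nat 8 rfl σ).trans h8
  have l₁ : HoldsVector σ₁ 20 21 (D.vertex v) p₁ := by
    subst hσ₁
    refine ⟨h1.1, Eq.trans ?_ h1.2⟩
    exact Function.update_of_ne (by omega) _ _
  have r₁ : HoldsVector σ₁ 22 23 (D.vertex v) p₂ := by
    subst hσ₁
    refine ⟨Eq.trans ?_ h2.1, Eq.trans ?_ h2.2⟩
    · exact (Function.update_of_ne (by omega) _ _).trans (Function.update_of_ne (by omega) _ _)
    · exact (Function.update_of_ne (by omega) _ _).trans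
        ((Function.update_of_ne (by omega) _ _).trans (Function.update_of_ne (by omega) _ _))
  rw [obtuseVertex, run_seq, ← hσ₁, run_seq]
  obtain ⟨σ₂, hσ₂⟩ : ∃ σ₂, σ₂ = obtuseCandidate.run σ₁ := ⟨_, rfl⟩
  have hc : AtCone σ₂ D child v p₁ p₂ := by
    refine ⟨hσ₂ ▸ hm₁.run rfl rfl rfl, hσ₂ ▸ hv₁.run rfl rfl rfl rfl, hσ₂ ▸ l₁.run rfl rfl,
      hσ₂ ▸ r₁.run rfl rfl, ?_⟩
    rw [_root_.cross, ← l₁.1, ← l₁.2, ← r₁.1, ← r₁.2, hσ₂]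
    rfl
  have hcand : HoldsCandidate σ₂ (mid p₁ p₂) (sqDist p₁ p₂ / 4) := by
    have e24 : σ₂.real 24 = σ₁.real 3 + (σ₁.real 20 + σ₁.real 22) / ((2 : ℤ) : ℝ) := by
      rw [hσ₂]; rfl
    have e25 : σ₂.real 25 = σ₁.real 4 + (σ₁.real 21 + σ₁.real 23) / ((2 : ℤ) : ℝ) := by
      rw [hσ₂]; rfl
    have e26 : σ₂.real 26 = ((σ₁.real 20 - σ₁.real 22) * (σ₁.real 20 - σ₁.real 22) +
        (σ₁.real 21 - σ₁.real 23) * (σ₁.real 21 - σ₁.real 23)) / ((4 : ℤ) : ℝ) := by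
      rw [hσ₂]; rfl
    refine ⟨?_, ?_, ?_⟩
    · rw [e24, l₁.1, r₁.1, hv₁.x, mid, between_apply]; push_cast; ring
    · rw [e25, l₁.2, r₁.2, hv₁.y, mid, between_apply]; push_cast; ring
    · rw [e26, l₁.1, r₁.1, l₁.2, r₁.2, sqDist]; push_cast; ring
  rw [← hσ₂]
  refine ⟨⟨?_, ?_, ?_⟩, testChildren_spec hc ?_⟩
  · exact (run_real 24 rfl σ₂).trans hcand.1
  · exact (run_real 25 rfl σ₂).trans hcand.2.1
  · exact (run_real 26 rfl σ₂).trans hcand.2.2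
  · rw [hσ₂]; exact (run_nat 8 rfl σ₁).trans h8₁

/-- The registers `0, 1` contain the centre and `2` the squared radius of the best lower bound. -/
def HoldsBest (σ : State) (c : Plane) (ρ : ℝ) : Prop :=
  σ.real 0 = c 0 ∧ σ.real 1 = c 1 ∧ σ.real 2 = ρ

theorem processVertex_spec {S : Finset Plane} (hD : D.IsFPVD S) (hσ : SearchMemory σ D child)
    (hv : σ.nat 3 = v + 1) : ∃ c₀ ρ₀ next,
      HoldsCandidate (processVertex.run (loadVertex.run σ)) c₀ ρ₀ ∧
      (processVertex.run (loadVertex.run σ)).nat 8 = encodePointer next ∧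
      ((IsOptimal S c₀ ρ₀ ∧ next = none) ∨
      ∃ p₁ p₂ p₃, DefinesVertex S p₁ p₂ p₃ (D.vertex v) ∧ Obtuse (D.vertex v) p₁ p₂ p₃ ∧
        c₀ = mid p₁ p₂ ∧ ρ₀ = sqDist p₁ p₂ / 4 ∧
        ((next = none ∧ ∀ i w, child v i = some w → ¬ Outside (D.vertex v) p₁ p₂ (D.vertex w)) ∨
          ∃ i w, child v i = some w ∧ Outside (D.vertex v) p₁ p₂ (D.vertex w) ∧
            next = some w)) := by
  have hm : SearchMemory (loadVertex.run σ) D child := hσ.run rfl rfl rfl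
  obtain ⟨hat, h8, h1, h2, h3⟩ := loadVertex_spec hσ hv
  obtain ⟨e11, e12, e13⟩ := loadVertex_products σ h1 h2 h3
  have hd := hD.vertexSite_spec v
  generalize loadVertex.run σ = σ₁ at *
  have t11 : (realLt 11 18).Holds σ₁ ↔ Obtuse (D.vertex v) _ _ _ :=
    show σ₁.real 11 < σ₁.real 18 ↔ _ by rw [e11, hat.zero, Obtuse]
  have t12 : (realLt 12 18).Holds σ₁ ↔ Obtuse (D.vertex v) _ _ _ :=
    show σ₁.real 12 < σ₁.real 18 ↔ _ by rw [e12, hat.zero, Obtuse]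
  have t13 : (realLt 13 18).Holds σ₁ ↔ Obtuse (D.vertex v) _ _ _ :=
    show σ₁.real 13 < σ₁.real 18 ↔ _ by rw [e13, hat.zero, Obtuse]
  rw [processVertex]
  by_cases b11 : (realLt 11 18).Holds σ₁
  · rw [run_ite_pos b11]
    obtain ⟨hc, next, hn, h⟩ := obtuseVertex_spec hm hat h8 (by norm_num) (by norm_num)
      (by norm_num) h1 h2
    exact ⟨_, _, next, hc, hn, .inr ⟨_, _, _, hd, t11.1 b11, rfl, rfl, h⟩⟩
  rw [run_ite_neg b11]
  by_cases b12 : (realLt 12 18).Holds σ₁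
  · rw [run_ite_pos b12]
    obtain ⟨hc, next, hn, h⟩ := obtuseVertex_spec hm hat h8 (by norm_num) (by norm_num)
      (by norm_num) h2 h3
    exact ⟨_, _, next, hc, hn, .inr ⟨_, _, _, hd.rotate, t12.1 b12, rfl, rfl, h⟩⟩
  rw [run_ite_neg b12]
  by_cases b13 : (realLt 13 18).Holds σ₁
  · rw [run_ite_pos b13]
    obtain ⟨hc, next, hn, h⟩ := obtuseVertex_spec hm hat h8 (by norm_num) (by norm_num)
      (by norm_num) h3 h1
    exact ⟨_, _, next, hc, hn, .inr ⟨_, _, _, hd.rotate.rotate, t13.1 b13, rfl, rfl, h⟩⟩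
  rw [run_ite_neg b13]
  refine ⟨D.vertex v, sqDist (D.vertex v) (D.site (D.vertexSite v 0)), none, ⟨hat.x, hat.y, ?_⟩,
    (run_nat 8 rfl σ₁).trans h8, .inl ⟨?_, rfl⟩⟩
  · have : (acuteCandidate.run σ₁).real 26 =
        σ₁.real 5 * σ₁.real 5 + σ₁.real 6 * σ₁.real 6 := rfl
    rw [this, h1.1, h1.2, sqDist]; ring
  · exact hd.isOptimal (fun h => b11 (t11.2 h)) (fun h => b12 (t12.2 h)) fun h => b13 (t13.2 h)

theorem searchBody_spec {S : Finset Plane} (hD : D.IsFPVD S) (hσ : SearchMemory σ D child)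
    (hv : σ.nat 3 = v + 1) {c : Plane} {ρ : ℝ} (hb : HoldsBest σ c ρ) :
    SearchMemory (searchBody.run σ) D child ∧ ∃ c' ρ' next,
      SearchStep D S child v c ρ c' ρ' next ∧ HoldsBest (searchBody.run σ) c' ρ' ∧
      (searchBody.run σ).nat 3 = encodePointer next := by
  refine ⟨hσ.run rfl rfl rfl, ?_⟩
  obtain ⟨c₀, ρ₀, next, hc, hn, h⟩ := processVertex_spec hD hσ hv
  have hb' : HoldsBest (processVertex.run (loadVertex.run σ)) c ρ :=
    ⟨((run_real 0 rfl _).trans (run_real 0 rfl σ)).trans hb.1,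
      ((run_real 1 rfl _).trans (run_real 1 rfl σ)).trans hb.2.1,
      ((run_real 2 rfl _).trans (run_real 2 rfl σ)).trans hb.2.2⟩
  have hrun : searchBody.run σ =
      (op (ncopy 3 8)).run (updateBest.run (processVertex.run (loadVertex.run σ))) := rfl
  rw [hrun]
  generalize processVertex.run (loadVertex.run σ) = σ₁ at *
  have h3 : ((op (ncopy 3 8)).run (updateBest.run σ₁)).nat 3 = encodePointer next :=
    (run_nat 8 rfl σ₁).trans hn
  by_cases hlt : (realLt 2 26).Holds σ₁
  · refine ⟨c₀, ρ₀, next, ⟨c₀, ρ₀, .inl ⟨?_, rfl, rfl⟩, h⟩, ?_, h3⟩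
    · rw [← hb'.2.2, ← hc.2.2]; exact hlt
    · rw [updateBest, run_ite_pos hlt]; exact hc
  · refine ⟨c, ρ, next, ⟨c₀, ρ₀, .inr ⟨?_, rfl, rfl⟩, h⟩, ?_, h3⟩
    · rw [← hb'.2.2, ← hc.2.2]; exact not_lt.1 hlt
    · rw [updateBest, run_ite_neg hlt]; exact hb'

/-- The search loop finds the optimal centre. -/
theorem exec_search {S : Finset Plane} (hD : D.IsFPVD S) (hS : InGeneralPosition S) (n : ℕ) :
    ∀ (A : Set (Fin D.numVertices)) (v : Fin D.numVertices) (c : Plane) (ρ : ℝ) (σ : State),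
      A.ncard ≤ n → IsCentroidTree D.graph child A v → SearchInvariant D S A c ρ →
      SearchMemory σ D child → σ.nat 3 = v + 1 → HoldsBest σ c ρ →
      ∃ τ t d c' ρ', Exec (loop (natLt 4 3) searchBody) σ τ t ∧
        t ≤ (searchBody.size + 1) * d + 1 ∧ 2 ^ d ≤ 2 * A.ncard ∧ IsOptimal S c' ρ' ∧
        HoldsBest τ c' ρ' := by
  induction n with
  | zero =>
    intro A v c ρ σ hn hA
    obtain ⟨A, v, hvA, -⟩ := hA
    exact absurd hn (not_le.2 ((Set.ncard_pos (Set.toFinite A)).2 ⟨v, hvA⟩))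
  | succ n ih =>
    intro A v c ρ σ hn hA hinv hσ hv hb
    have hpos : 0 < A.ncard := by
      obtain ⟨A, v, hvA, -⟩ := hA
      exact (Set.ncard_pos (Set.toFinite A)).2 ⟨v, hvA⟩
    have htest : (natLt 4 3).Holds σ := show σ.nat 4 < σ.nat 3 by rw [hσ.zero, hv]; omega
    obtain ⟨s, hs, hbody⟩ := exec_run (f := fun _ => true) (P := searchBody) rfl σ
    obtain ⟨hσ', c', ρ', next, hstep, hb', h3⟩ := searchBody_spec hD hσ hv hb
    obtain ⟨hnone, hsome⟩ := hstep.invariant hD hS hA hinv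
    cases next with
    | none =>
      have hend : ¬ (natLt 4 3).Holds (searchBody.run σ) :=
        show ¬ (_ < _) by rw [hσ'.zero, h3]; exact lt_irrefl _
      -- Here `d` counts the rounds. One round needs only `A` nonempty; the `+ 1` in the time bound
      -- pays for the failing loop test.
      exact ⟨_, _, 1, c', ρ', .loop_true htest hbody (.loop_false hend), by omega, by omega,
        hnone rfl, hb'⟩
    | some w =>
      obtain ⟨C, hhalf, hC, hinv'⟩ := hsome w rfl
      obtain ⟨τ, t, d, c'', ρ'', hex, ht, hd, hopt, hbest⟩ :=
        ih C w c' ρ' (searchBody.run σ) (by omega) hC hinv' hσ' h3 hb'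
      refine ⟨τ, _, d + 1, c'', ρ'', .loop_true htest hbody hex, ?_, ?_, hopt, hbest⟩
      · rw [Nat.mul_succ]; omega
      · rw [pow_succ]; omega

end Search

/-! ### The first lower bound -/

/-- Without vertices an edge is a full bisector and contains its midpoint, which is then optimal. If
there is no edge either, `S` is a single point. -/
theorem firstBound_spec {S : Finset Plane} (hS : S.Nonempty) {D : DiagramTables} (hD : D.IsFPVD S)
    {root : Option (Fin D.numVertices)}
    {child : Fin D.numVertices → Fin 3 → Option (Fin D.numVertices)} {σ : State}
    (hσ : HoldsInput σ D root child) :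
    SearchMemory (firstBound.run σ) D child ∧
      (firstBound.run σ).nat 3 = encodePointer root ∧
      ∃ c ρ, HoldsBest (firstBound.run σ) c ρ ∧ LowerBound S c ρ ∧
        (IsEmpty (Fin D.numVertices) → IsOptimal S c ρ) := by
  obtain ⟨σ₁, hσ₁⟩ : ∃ σ₁, σ₁ =
    (ops [nconst 4 0, nconst 5 1, rload 0 0 4, rload 1 1 4, rconst 2 0]).run σ := ⟨_, rfl⟩
  have hrun : firstBound.run σ = (ite (natLt 4 2) edgeBound skip).run σ₁ := by rw [hσ₁]; rfl
  have hm : SearchMemory σ₁ D child := by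
    subst hσ₁
    exact ⟨rfl, rfl, hσ.site, hσ.vertex, hσ.vertexSite, hσ.child⟩
  refine ⟨hrun ▸ hm.run rfl rfl rfl, (run_nat 3 rfl σ).trans hσ.root, ?_⟩
  rw [hrun]
  have hN : 0 < D.numSites := by
    obtain ⟨p, hp⟩ := hS
    have : p ∈ Set.range D.site := by rw [hD.site_range]; exact hp
    obtain ⟨i, -⟩ := this
    exact i.pos
  have htest : (natLt 4 2).Holds σ₁ ↔ 0 < D.numEdges := by
    rw [← hσ.numEdges, hσ₁]; rfl
  by_cases hE : 0 < D.numEdges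
  · rw [run_ite_pos (htest.2 hE)]
    obtain ⟨e, he⟩ : ∃ e : Fin D.numEdges, e = ⟨0, hE⟩ := ⟨_, rfl⟩
    obtain ⟨ha, hb, hab, x, hx, -⟩ := hD.edgeSite_spec e
    have hx₀ : σ₁.realArr 0 (σ₁.natArr 9 (σ₁.nat 4)) = D.site (D.edgeSite e 0) 0 := by
      rw [← hσ.site (D.edgeSite e 0) 0, ← hσ.edgeSite e 0, hσ₁, he]; rfl
    have hy₀ : σ₁.realArr 1 (σ₁.natArr 9 (σ₁.nat 4)) = D.site (D.edgeSite e 0) 1 := by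
      rw [← hσ.site (D.edgeSite e 0) 1, ← hσ.edgeSite e 0, hσ₁, he]; rfl
    have hx₁ : σ₁.realArr 0 (σ₁.natArr 10 (σ₁.nat 4)) = D.site (D.edgeSite e 1) 0 := by
      rw [← hσ.site (D.edgeSite e 1) 0, ← hσ.edgeSite e 1, hσ₁, he]; rfl
    have hy₁ : σ₁.realArr 1 (σ₁.natArr 10 (σ₁.nat 4)) = D.site (D.edgeSite e 1) 1 := by
      rw [← hσ.site (D.edgeSite e 1) 1, ← hσ.edgeSite e 1, hσ₁, he]; rfl
    refine ⟨mid (D.site (D.edgeSite e 0)) (D.site (D.edgeSite e 1)),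
      sqDist (D.site (D.edgeSite e 0)) (D.site (D.edgeSite e 1)) / 4, ⟨?_, ?_, ?_⟩,
      lowerBound_mid ha hb, fun hV => isOptimal_mid_of_mem ha hb
        (hD.mem_edge_of_isEmpty hV ha hb hab hx _ (by rw [sqDist_mid_left, sqDist_mid_right])).1⟩
    · have : (edgeBound.run σ₁).real 0 = (σ₁.realArr 0 (σ₁.natArr 9 (σ₁.nat 4)) +
          σ₁.realArr 0 (σ₁.natArr 10 (σ₁.nat 4))) / ((2 : ℤ) : ℝ) := rfl
      rw [this, hx₀, hx₁, mid, between_apply]; push_cast; ring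
    · have : (edgeBound.run σ₁).real 1 = (σ₁.realArr 1 (σ₁.natArr 9 (σ₁.nat 4)) +
          σ₁.realArr 1 (σ₁.natArr 10 (σ₁.nat 4))) / ((2 : ℤ) : ℝ) := rfl
      rw [this, hy₀, hy₁, mid, between_apply]; push_cast; ring
    · have : (edgeBound.run σ₁).real 2 = ((σ₁.realArr 0 (σ₁.natArr 9 (σ₁.nat 4)) -
          σ₁.realArr 0 (σ₁.natArr 10 (σ₁.nat 4))) * (σ₁.realArr 0 (σ₁.natArr 9 (σ₁.nat 4)) -
          σ₁.realArr 0 (σ₁.natArr 10 (σ₁.nat 4))) + (σ₁.realArr 1 (σ₁.natArr 9 (σ₁.nat 4)) -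
          σ₁.realArr 1 (σ₁.natArr 10 (σ₁.nat 4))) * (σ₁.realArr 1 (σ₁.natArr 9 (σ₁.nat 4)) -
          σ₁.realArr 1 (σ₁.natArr 10 (σ₁.nat 4)))) / ((4 : ℤ) : ℝ) := rfl
      rw [this, hx₀, hx₁, hy₀, hy₁, sqDist]; push_cast; ring
  · rw [run_ite_neg fun h => hE (htest.1 h)]
    have hp := hD.site_mem ⟨0, hN⟩
    have hlb : LowerBound S (D.site ⟨0, hN⟩) 0 := fun x => ⟨_, hp, by rw [zero_add]⟩
    refine ⟨D.site ⟨0, hN⟩, 0, ⟨?_, ?_, ?_⟩, hlb, fun hV => ⟨fun q hq => ?_, hlb⟩⟩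
    · rw [← hσ.site ⟨0, hN⟩ 0, hσ₁]; rfl
    · rw [← hσ.site ⟨0, hN⟩ 1, hσ₁]; rfl
    · rw [hσ₁]; exact Int.cast_zero
    · by_cases hpq : D.site ⟨0, hN⟩ = q
      · rw [hpq, sqDist]; simp
      · exact absurd (hD.exists_edge_of_isEmpty hV hp hq hpq) hE

/-! ### Running time -/

/-- A vertex is determined by its defining triple. The crude cubic bound suffices because only its
logarithm matters. -/
theorem numVertices_le {S : Finset Plane} {D : DiagramTables} (hD : D.IsFPVD S) :
    D.numVertices ≤ S.card ^ 3 := by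
  have h1 : D.numSites ≤ S.card := by
    have := Finset.card_le_card_of_injOn (s := Finset.univ) (t := S) D.site
      (fun i _ => hD.site_mem i) hD.site_injective.injOn
    simpa using this
  have h2 : Function.Injective D.vertexSite := by
    intro i j hij
    apply hD.vertex_injective
    have hi := (hD.vertexSite_spec i).2.2.2.2.2.2
    rw [hij, (hD.vertexSite_spec j).2.2.2.2.2.2] at hi
    exact (Set.singleton_injective hi).symm
  have h3 := Fintype.card_le_of_injective _ h2
  simp only [Fintype.card_fin, Fintype.card_fun] at h3
  exact h3.trans (Nat.pow_le_pow_left h1 3)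

theorem depth_le {n k d : ℕ} (hn : 0 < n) (hk : k ≤ n ^ 3) (hd : 2 ^ d ≤ 2 * k) :
    (d : ℝ) ≤ 1 + 6 * Real.log n := by
  have h : (2 : ℝ) ^ d ≤ 2 * (n : ℝ) ^ 3 := by exact_mod_cast hd.trans (Nat.mul_le_mul_left 2 hk)
  have hn' : (0 : ℝ) < n := by exact_mod_cast hn
  have hlog := Real.log_le_log (by positivity) h
  rw [Real.log_pow, Real.log_mul (by norm_num) (by positivity), Real.log_pow] at hlog
  push_cast at hlog
  have h2 := Real.log_two_gt_d9
  have hL : 0 ≤ Real.log n := Real.log_nonneg (by exact_mod_cast hn)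
  by_contra! hcon
  -- From `d log 2 ≤ log 2 + 3 log n` and `log 2 > 1/2`.
  nlinarith

theorem holdsSmallestEnclosingDisk_of_isOptimal {S : Finset Plane} (hS : S.Nonempty) {c : Plane}
    {ρ : ℝ} (h : IsOptimal S c ρ) {σ : State} (hσ : HoldsBest σ c ρ) :
    HoldsSmallestEnclosingDisk σ S := by
  obtain ⟨hρ, hdisk⟩ := h.isSmallestEnclosingDisk hS
  exact ⟨c, √ρ, hdisk, hσ.1, hσ.2.1, by rw [Real.sq_sqrt hρ]; exact hσ.2.2⟩

end RealRAM

theorem mainTheorem5 :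
    ∃ (P : RealRAM.Program) (K : ℝ),
      ∀ S : Finset Plane, S.Nonempty → InGeneralPosition S →
      ∀ D : DiagramTables, D.IsFPVD S →
      ∀ (root : Option (Fin D.numVertices))
        (child : Fin D.numVertices → Fin 3 → Option (Fin D.numVertices)),
        IsCentroidDecomposition D.graph root child →
      ∀ σ : RealRAM.State, RealRAM.HoldsInput σ D root child →
      ∃ (τ : RealRAM.State) (t : ℕ), RealRAM.Exec P σ τ t ∧
        (t : ℝ) ≤ K * (1 + Real.log (S.card : ℝ)) ∧
        RealRAM.HoldsSmallestEnclosingDisk τ S := by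
  refine ⟨RealRAM.diskSearch,
    -- The `1` is the failing loop test, and the `6` comes from the bound `1 + 6 log n` on the
    -- number of rounds, each costing the body and one test.
    RealRAM.firstBound.size + 1 + 6 * (RealRAM.searchBody.size + 1), ?_⟩
  intro S hne hS D hD root child hroot σ hσ
  obtain ⟨s, hs, hfirst⟩ :=
    RealRAM.Program.exec_run (f := fun _ => true) (P := RealRAM.firstBound) rfl σ
  obtain ⟨hm, h3, c, ρ, hbest, hlb, hempty⟩ := RealRAM.firstBound_spec hne hD hσ
  have hL : 0 ≤ Real.log (S.card : ℝ) := Real.log_nonneg (by exact_mod_cast hne.card_pos)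
  have hs' : (s : ℝ) ≤ RealRAM.firstBound.size := by exact_mod_cast hs
  have hF : (0 : ℝ) ≤ RealRAM.firstBound.size := Nat.cast_nonneg _
  have hB : (0 : ℝ) ≤ RealRAM.searchBody.size := Nat.cast_nonneg _
  cases root with
  | none =>
    have hend : ¬ (RealRAM.Test.natLt 4 3).Holds (RealRAM.firstBound.run σ) :=
      show ¬ (_ < _) by rw [hm.zero, h3]; exact lt_irrefl _
    refine ⟨_, _, .seq hfirst (.loop_false hend), ?_,
      RealRAM.holdsSmallestEnclosingDisk_of_isOptimal hne (hempty (hroot.1 rfl)) hbest⟩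
    push_cast
    nlinarith [mul_nonneg hF hL, mul_nonneg hB hL]
  | some r =>
    obtain ⟨j, hj, -⟩ := hD.exists_reachable_terminal hS r
    obtain ⟨τ, t, d, c', ρ', hex, ht, hd, hopt, hb⟩ := RealRAM.exec_search hD hS _ Set.univ r c ρ _
      le_rfl (hroot.2 r rfl) ⟨hlb, .inr ⟨hD.connectedOn_univ hS, j, trivial, hj⟩⟩ hm h3 hbest
    refine ⟨τ, _, .seq hfirst hex, ?_, RealRAM.holdsSmallestEnclosingDisk_of_isOptimal hne hopt hb⟩
    have hk : (Set.univ : Set (Fin D.numVertices)).ncard ≤ S.card ^ 3 := by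
      rw [Set.ncard_univ, Nat.card_fin]; exact RealRAM.numVertices_le hD
    have hd' := RealRAM.depth_le hne.card_pos hk hd
    have ht' : (t : ℝ) ≤ (RealRAM.searchBody.size + 1) * d + 1 := by exact_mod_cast ht
    have hmul := mul_le_mul_of_nonneg_left hd' (by linarith : (0 : ℝ) ≤ RealRAM.searchBody.size + 1)
    push_cast
    nlinarith [mul_nonneg hF hL, mul_nonneg hB hL]
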